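/- Throughout, graphs are finite and simple, $|G|$ is the number of vertices of $G$, $\log$ is the logarithm to base $2$ and $\log^2\Delta=(\log\Delta)^2$. The Ramsey number $r(G,H)$ is the smallest $n$ such that every $2$-colouring of the edges of $K_n$ contains a copy of $G$ in the first colour or a copy of $H$ in the second. A set $U$ of vertices of a graph $K$ is bi-$(\varepsilon,\gamma)$-dense if $e(X,Y)\ge\gamma|X||Y|$ for all disjoint $X,Y\subseteq U$ with $|X|,|Y|\ge\varepsilon|U|$, where $e(X,Y)$ is the number of edges of $K$ between $X$ and $Y$. An $H$-tiling of a graph $F$ is a collection of vertex-disjoint (not necessarily induced) copies of $H$ in $F$ covering all but at most $|F| \bmod |H|$ vertices of $F$. For a set $U\subseteq V(K)$ and an integer $r\ge 0$, an $(H,r)$-absorber for $U$ in $K$ is an induced subgraph $A$ of $K$ such that for every $R\subseteq U$ with $|R|\le r$ the graph $K[V(A)\cup R]$ has an $H$-tiling. **Lemma.** Let $\Delta\ge 2$ be an integer, let $G$ and $H$ be graphs of maximum degree at most $\Delta$, and let $k=\max\{|G|,|H|\}$. Let $K$ be a graph of order $N\ge 2^{512\Delta\log^2\Delta}k$ whose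 complement contains no copy of $G$ as a (not necessarily induced) subgraph. Then there exist a set $X\subseteq V(K)$ with $$|X|\ge \frac{N}{2^{200\Delta\log^2\Delta}}$$ which is bi-$(2^{-10\Delta-11}\Delta^{-2\Delta-4},\,2^{-4}\Delta^{-1})$-dense in $K$, and an $(H,r(G,H))$-absorber for $X$ in $K$ of order at most $2^{200\Delta\log^2\Delta}k$. -/

import Mathlib

namespace RamseyTiling

/-- The Ramsey number `r(G, H)`: the smallest `N` such that every 2-colouring of the edges of the
complete graph on `N` vertices contains `G` in the first colour or `H` in the second. A colouring
is given by the graph `C` of the edges of the first colour, the edges of the second colour being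
those of the complement `Cᶜ`. -/
noncomputable def ramsey {α β : Type*} (G : SimpleGraph α) (H : SimpleGraph β) : ℕ :=
  sInf {N : ℕ | ∀ C : SimpleGraph (Fin N), G.IsContained C ∨ H.IsContained Cᶜ}

/-- A vertex set `U` is bi-`(ε, γ)`-dense in `G` if all disjoint `X, Y ⊆ U` of order at least
`ε|U|` satisfy `e(X, Y) / (|X||Y|) ≥ γ`. -/
def IsBiDense {V : Type*} (G : SimpleGraph V) [DecidableRel G.Adj] (ε γ : ℝ)
    (U : Finset V) : Prop :=
  ∀ X Y : Finset V, X ⊆ U → Y ⊆ U → Disjoint X Y →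
    ε * (U.card : ℝ) ≤ (X.card : ℝ) → ε * (U.card : ℝ) ≤ (Y.card : ℝ) →
      γ ≤ ((G.edgeDensity X Y : ℚ) : ℝ)

/-- The graph `G` (with finite vertex set) has an `H`-tiling: a collection of vertex-disjoint
copies of `H` in `G` (not necessarily induced) that covers all but at most `|G| mod |H|`
vertices of `G`. -/
def HasTiling {β V : Type*} (H : SimpleGraph β) (G : SimpleGraph V) : Prop :=
  ∃ (n : ℕ) (f : Fin n → SimpleGraph.Copy H G),
    (∀ i j : Fin n, i ≠ j → Disjoint (Set.range (f i)) (Set.range (f j))) ∧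
      (⋃ i, Set.range (f i))ᶜ.ncard ≤ Nat.card V % Nat.card β

/-- The subgraph of `K` induced by the vertex set `A` is an `(H, r)`-absorber for the vertex
set `U` in `K`: for every `R ⊆ U` of order at most `r`, the graph `K[A ∪ R]` has an
`H`-tiling. -/
def IsAbsorber {β V : Type*} (H : SimpleGraph β) (r : ℕ) (K : SimpleGraph V)
    (A U : Finset V) : Prop :=
  ∀ R : Finset V, R ⊆ U → R.card ≤ r →
    HasTiling H (K.induce ((A : Set V) ∪ (R : Set V)))

end RamseyTiling

/-! A `G`-free complement prevents `K` from being sparse on a large set. If no large subset of a set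
were bi-dense, sparse pairs could be nested like a binary tree to produce a large set of low density
(`exists_sparse_subset`), and the complement would contain `G` greedily there
(`isContained_compl_of_sparse`). Hence every large set contains a large bi-dense one
(`exists_denseAbove_subset`). Graphs of bounded degree embed greedily into bi-dense sets, even with
large prescribed candidate sets (`exists_embedding_of_denseAbove`). These two facts also bound
`ramsey G H` (`ramsey_le`), so it suffices to absorb sets of at most that many vertices.

The absorber is built inside one bi-dense set `B` from a bounded-degree template
(`exists_template`): slots and fillers such that, whichever `D₀` of `n` flexible fillers are
deleted, the slots can be matched to the remaining fillers. Slots are vertices of disjoint copies of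
`H`, pairwise at distance at least three; each is replaced by all its possible fillers, and the
resulting graph is embedded in `B`. Let `Y` be the image of the flexible fillers. If every vertex of
a small set `R` has many neighbours in `Y`, then `R` is covered by copies of `H` whose other
vertices lie in `Y` (`exists_cover`). This uses up at most `D₀` flexible fillers, and the template
completes the tiling with those that remain (`exists_absorber_of_denseAbove`).

It remains to find many vertices of high degree into some such `Y`. If every absorber had few of
them, `G` could be embedded in the complement colour class by colour class, each class going into
the `Y` of a new absorber (`exists_many_high_degree`). The required set is a bi-dense subset of the
high-degree vertices. -/

namespace RamseyTiling

open Finset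

/-! ### Neighbourhoods, edge counts and a Markov inequality. -/

section Counting

variable {V : Type*}

open Classical in
/-- The neighbours of `v` inside the finite set `S`. -/
noncomputable def nbIn (K : SimpleGraph V) (S : Finset V) (v : V) : Finset V :=
  S.filter (K.Adj v)

/-- The number of pairs `(x, y) ∈ X × Y` that are edges. -/
noncomputable def edgeCount (K : SimpleGraph V) (X Y : Finset V) : ℕ :=
  ∑ x ∈ X, (nbIn K Y x).card

lemma mem_nbIn {K : SimpleGraph V} {S : Finset V} {v u : V} :
    u ∈ nbIn K S v ↔ u ∈ S ∧ K.Adj v u := by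
  classical
  simp [nbIn]

lemma nbIn_subset (K : SimpleGraph V) (S : Finset V) (v : V) : nbIn K S v ⊆ S :=
  fun _ h => (mem_nbIn.1 h).1

lemma nbIn_mono (K : SimpleGraph V) {S T : Finset V} (h : S ⊆ T) (v : V) :
    nbIn K S v ⊆ nbIn K T v :=
  fun _ hu => mem_nbIn.2 ⟨h (mem_nbIn.1 hu).1, (mem_nbIn.1 hu).2⟩

lemma edgeCount_comm (K : SimpleGraph V) (X Y : Finset V) :
    edgeCount K X Y = edgeCount K Y X := by
  classical
  have := Finset.sum_card_bipartiteAbove_eq_sum_card_bipartiteBelow (s := X) (t := Y) K.Adj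
  simp only [edgeCount, nbIn]
  simp only [Finset.bipartiteAbove, Finset.bipartiteBelow] at this
  rw [this]
  refine Finset.sum_congr rfl fun y _ => ?_
  congr 1
  ext x
  simp [K.adj_comm]

lemma edgeCount_le (K : SimpleGraph V) (X Y : Finset V) :
    edgeCount K X Y ≤ X.card * Y.card := by
  refine (Finset.sum_le_card_nsmul X _ Y.card fun x _ => card_le_card (nbIn_subset K Y x)).trans ?_
  simp

lemma edgeCount_union_self [DecidableEq V] (K : SimpleGraph V) {X Y : Finset V}
    (h : Disjoint X Y) :
    edgeCount K (X ∪ Y) (X ∪ Y) = edgeCount K X X + edgeCount K Y Y + 2 * edgeCount K X Y := by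
  have key : ∀ Z, edgeCount K (X ∪ Y) Z = edgeCount K X Z + edgeCount K Y Z := fun Z => by
    simp [edgeCount, Finset.sum_union h]
  rw [key, edgeCount_comm K X, edgeCount_comm K Y, key, key, edgeCount_comm K Y X]
  ring

/-- If `X` sends few edges to `Y` then at least a sixth of its vertices have degree into `Y` at
most `6/5` of the average bound. -/
lemma card_le_six_mul_card_low (K : SimpleGraph V) (X Y : Finset V) (d : ℝ)
    (h : (edgeCount K X Y : ℝ) ≤ d * X.card * Y.card) :
    ∃ X₀ ⊆ X, (X.card : ℝ) ≤ 6 * X₀.card ∧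
      ∀ x ∈ X₀, ((nbIn K Y x).card : ℝ) ≤ 6 / 5 * d * Y.card := by
  classical
  refine ⟨X.filter fun x => ((nbIn K Y x).card : ℝ) ≤ 6 / 5 * d * Y.card, filter_subset _ _, ?_,
    fun x hx => (mem_filter.1 hx).2⟩
  set p : V → Prop := fun x => ((nbIn K Y x).card : ℝ) ≤ 6 / 5 * d * Y.card with hp
  have hsplit : ((X.filter p).card : ℝ) + (X.filter fun x => ¬ p x).card = X.card := by
    exact_mod_cast Finset.card_filter_add_card_filter_not (s := X) p
  have h1 : ∑ x ∈ X.filter (fun x => ¬ p x), ((nbIn K Y x).card : ℝ) ≤ edgeCount K X Y := by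
    rw [edgeCount, Nat.cast_sum]
    exact Finset.sum_le_sum_of_subset_of_nonneg (filter_subset _ _) fun _ _ _ => Nat.cast_nonneg _
  have h2 : ((X.filter fun x => ¬ p x).card : ℝ) * (6 / 5 * d * Y.card) ≤
      ∑ x ∈ X.filter (fun x => ¬ p x), ((nbIn K Y x).card : ℝ) := by
    rw [← nsmul_eq_mul]
    refine Finset.card_nsmul_le_sum _ _ _ fun x hx => ?_
    exact le_of_lt (not_le.1 (mem_filter.1 hx).2)
  rcases (X.filter fun x => ¬ p x).eq_empty_or_nonempty with he | ⟨x, hx⟩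
  · rw [he] at hsplit
    simp only [card_empty, Nat.cast_zero, add_zero] at hsplit
    have : (0 : ℝ) ≤ (X.filter p).card := Nat.cast_nonneg _
    linarith
  -- Dividing by the threshold needs it to be positive. If it is not, the edge bound forces the
  -- exceptional vertex `x` to have degree zero, hence `d|Y| < 0`, and the edge count would be
  -- negative.
  by_cases hq : d * Y.card ≤ 0
  · have hxp := not_le.1 (mem_filter.1 hx).2
    have hlt : ∑ x ∈ X.filter (fun x => ¬ p x), (6 / 5 * d * (Y.card : ℝ)) <
        ∑ x ∈ X.filter (fun x => ¬ p x), ((nbIn K Y x).card : ℝ) :=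
      Finset.sum_lt_sum_of_nonempty ⟨x, hx⟩ fun y hy => not_le.1 (mem_filter.1 hy).2
    rw [Finset.sum_const, nsmul_eq_mul] at hlt
    have hX : (0 : ℝ) ≤ X.card := Nat.cast_nonneg _
    have h0 : (edgeCount K X Y : ℝ) ≤ 0 := h.trans (by nlinarith)
    have h0' : ∑ x ∈ X.filter (fun x => ¬ p x), ((nbIn K Y x).card : ℝ) ≤ 0 := h1.trans h0
    have hx0 : ((nbIn K Y x).card : ℝ) ≤ 0 :=
      (Finset.single_le_sum (f := fun x => ((nbIn K Y x).card : ℝ))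
        (fun _ _ => Nat.cast_nonneg _) hx).trans h0'
    have hx1 : (0 : ℝ) ≤ (nbIn K Y x).card := Nat.cast_nonneg _
    have hY : ((nbIn K Y x).card : ℝ) = 0 := le_antisymm hx0 hx1
    have hlt0 : d * (Y.card : ℝ) < 0 := by linarith
    have hXpos : (0 : ℝ) < X.card := by
      exact_mod_cast card_pos.2 ⟨x, (mem_filter.1 hx).1⟩
    have : (0 : ℝ) ≤ edgeCount K X Y := Nat.cast_nonneg _
    nlinarith
  · push Not at hq
    have h3 : ((X.filter fun x => ¬ p x).card : ℝ) * (6 / 5) ≤ X.card := by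
      have := h2.trans (h1.trans h)
      have h4 : (((X.filter fun x => ¬ p x).card : ℝ) * (6 / 5)) * (d * Y.card) ≤
          X.card * (d * Y.card) := by linarith
      exact le_of_mul_le_mul_right h4 hq
    linarith

end Counting

/-! ### Nested sparse pairs give a sparse set. -/

section Sparse

variable {V : Type*}

/-- Iterating the failure of bi-density gives a set of prescribed size and low density. -/
lemma exists_sparse_subset (K : SimpleGraph V) {γ ε : ℝ} (hγ : 0 ≤ γ) (hε : 0 < ε) (hε1 : ε ≤ 1)
    (W : Finset V) (s : ℝ)
    (hno : ∀ B ⊆ W, s ≤ B.card → ∃ X ⊆ B, ∃ Y ⊆ B, Disjoint X Y ∧ ε * B.card ≤ X.card ∧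
      ε * B.card ≤ Y.card ∧ (edgeCount K X Y : ℝ) < γ * X.card * Y.card)
    (m : ℕ) (M : ℝ) (hs : s ≤ M) (hm : (m : ℝ) ≤ M) (j : ℕ) :
    ∀ W' ⊆ W, (6 / ε) ^ j * M ≤ W'.card → ∃ U ⊆ W', U.card = 2 ^ j * m ∧
      (edgeCount K U U : ℝ) ≤ (36 / 25 * γ + 1 / 2 ^ j) * U.card ^ 2 := by
  classical
  have hM : 0 ≤ M := (Nat.cast_nonneg m).trans hm
  induction j with
  | zero =>
    intro W' _ hc
    have : m ≤ W'.card := by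
      have : (m : ℝ) ≤ W'.card := hm.trans (by simpa using hc)
      exact_mod_cast this
    obtain ⟨U, hU, hUc⟩ := exists_subset_card_eq this
    refine ⟨U, hU, by simpa using hUc, ?_⟩
    have : (edgeCount K U U : ℝ) ≤ U.card * U.card := by exact_mod_cast edgeCount_le K U U
    have h2 : (0 : ℝ) ≤ γ * U.card ^ 2 := by positivity
    norm_num
    nlinarith
  | succ j ih =>
    intro W' hW' hc
    have hq : 1 ≤ (6 / ε) := by rw [le_div_iff₀ hε]; linarith
    have hsW : s ≤ W'.card := by
      refine hs.trans (le_trans ?_ hc)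
      have : 1 ≤ (6 / ε) ^ (j + 1) := one_le_pow₀ hq
      nlinarith
    obtain ⟨X, hX, Y, hY, hdisj, hXc, hYc, he⟩ := hno W' hW' hsW
    have hbig : 6 * ((6 / ε) ^ j * M) ≤ ε * W'.card := by
      have : (6 / ε) ^ (j + 1) * M = (6 / ε) ^ j * M * (6 / ε) := by ring
      rw [this] at hc
      calc 6 * ((6 / ε) ^ j * M) = ε * ((6 / ε) ^ j * M * (6 / ε)) := by field_simp
        _ ≤ _ := mul_le_mul_of_nonneg_left hc hε.le
    -- A density bound is not inherited by subsets, but a degree bound is. So low-degree vertices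
    -- are selected before recursing, once on each side: this costs a factor 6 in size and 6/5 in
    -- density, whence `6 / ε` and `36/25`.
    obtain ⟨X₀, hX₀, hX₀c, hX₀d⟩ := card_le_six_mul_card_low K X Y γ he.le
    obtain ⟨X', hX', hX'c, hX'e⟩ := ih X₀ (hX₀.trans (hX.trans hW')) (by linarith)
    have he1 : (edgeCount K Y X' : ℝ) ≤ 6 / 5 * γ * Y.card * X'.card := by
      rw [edgeCount_comm, edgeCount, Nat.cast_sum]
      refine (Finset.sum_le_card_nsmul X' _ _ fun x hx => hX₀d x (hX' hx)).trans (le_of_eq ?_)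
      rw [nsmul_eq_mul]; ring
    obtain ⟨Y₀, hY₀, hY₀c, hY₀d⟩ := card_le_six_mul_card_low K Y X' _ he1
    obtain ⟨Y', hY', hY'c, hY'e⟩ := ih Y₀ (hY₀.trans (hY.trans hW')) (by linarith)
    have he2 : (edgeCount K X' Y' : ℝ) ≤ 36 / 25 * γ * X'.card * Y'.card := by
      rw [edgeCount_comm, edgeCount, Nat.cast_sum]
      refine (Finset.sum_le_card_nsmul Y' _ _ fun x hx => hY₀d x (hY' hx)).trans (le_of_eq ?_)
      rw [nsmul_eq_mul]; ring
    have hd' : Disjoint X' Y' :=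
      disjoint_of_subset_left (hX'.trans hX₀) (disjoint_of_subset_right (hY'.trans hY₀) hdisj)
    refine ⟨X' ∪ Y', union_subset (hX'.trans (hX₀.trans hX)) (hY'.trans (hY₀.trans hY)), ?_, ?_⟩
    · rw [card_union_of_disjoint hd', hX'c, hY'c]; ring
    · rw [edgeCount_union_self K hd', card_union_of_disjoint hd', hX'c, hY'c]
      rw [hX'c] at hX'e he2
      rw [hY'c] at hY'e he2
      -- With `δ = 36/25 γ`, the density of the union is at most `(δ + 2⁻ʲ)/2 + δ/2 = δ + 2⁻ʲ⁻¹`: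
      -- only the excess over `δ` is halved.
      push_cast at *
      set a : ℝ := 2 ^ j * m
      have h2 : (1 : ℝ) / 2 ^ (j + 1) = 1 / 2 * (1 / 2 ^ j) := by
        rw [pow_succ]; field_simp
      rw [h2]
      nlinarith

end Sparse

/-! ### Sparse sets and embeddings in the complement; large bi-dense subsets. -/

section Complement

variable {V α : Type*}

/-- A bounded-degree graph embeds greedily in the complement of a sparse graph. -/
lemma isContained_compl_of_sparse [Fintype α] [Nonempty α] (K : SimpleGraph V)
    (G : SimpleGraph α) {Δ : ℕ} (hG : ∀ x, (nbIn G univ x).card ≤ Δ) (U : Finset V) {δ : ℝ}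
    (hδ0 : 0 < δ) (hδ : 4 * Δ * δ ≤ 98 / 100)
    (he : (edgeCount K U U : ℝ) ≤ δ * U.card ^ 2) (hU : 101 * Fintype.card α ≤ U.card) :
    G.IsContained Kᶜ := by
  classical
  have hα : 0 < Fintype.card α := Fintype.card_pos
  have hUpos : (0 : ℝ) < U.card := by
    have : 0 < U.card := by omega
    exact_mod_cast this
  set U' := U.filter fun u => ((nbIn K U u).card : ℝ) ≤ 2 * δ * U.card with hU'
  have hU'c : (U.card : ℝ) ≤ 2 * U'.card := by
    have hsplit : (U'.card : ℝ) + (U.filter fun u => ¬ ((nbIn K U u).card : ℝ) ≤ 2 * δ * U.card).card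
        = U.card := by
      exact_mod_cast Finset.card_filter_add_card_filter_not (s := U) _
    have h1 : ∑ x ∈ U.filter (fun u => ¬ ((nbIn K U u).card : ℝ) ≤ 2 * δ * U.card),
        ((nbIn K U x).card : ℝ) ≤ edgeCount K U U := by
      rw [edgeCount, Nat.cast_sum]
      exact Finset.sum_le_sum_of_subset_of_nonneg (filter_subset _ _)
        fun _ _ _ => Nat.cast_nonneg _
    have h2 : ((U.filter fun u => ¬ ((nbIn K U u).card : ℝ) ≤ 2 * δ * U.card).card : ℝ) *
        (2 * δ * U.card) ≤ ∑ x ∈ U.filter (fun u => ¬ ((nbIn K U u).card : ℝ) ≤ 2 * δ * U.card),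
        ((nbIn K U x).card : ℝ) := by
      rw [← nsmul_eq_mul]
      exact Finset.card_nsmul_le_sum _ _ _ fun x hx => (not_le.1 (mem_filter.1 hx).2).le
    have h3 : (2 * ((U.filter fun u => ¬ ((nbIn K U u).card : ℝ) ≤ 2 * δ * U.card).card : ℝ)) *
        (δ * U.card) ≤ U.card * (δ * U.card) := by
      have := h2.trans (h1.trans he)
      linarith
    have := le_of_mul_le_mul_right h3 (by positivity)
    linarith
  have key : ∀ T : Finset α, ∃ φ : α → V, (∀ x ∈ T, φ x ∈ U') ∧ Set.InjOn φ T ∧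
      ∀ x ∈ T, ∀ y ∈ T, G.Adj x y → ¬ K.Adj (φ x) (φ y) := by
    intro T
    induction T using Finset.induction_on with
    | empty =>
      have : Nonempty V := by
        obtain ⟨v, _⟩ := card_pos.1 (by exact_mod_cast hUpos : 0 < U.card)
        exact ⟨v⟩
      exact ⟨fun _ => Classical.arbitrary V, by simp, by simp, by simp⟩
    | insert x T hx ih =>
      obtain ⟨φ, hφ, hinj, hadj⟩ := ih
      set bad := T.image φ ∪ (nbIn G T x).biUnion fun y => nbIn K U (φ y) with hbad
      have hTc : T.card + 1 ≤ Fintype.card α := by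
        rw [← card_insert_of_notMem hx]; exact card_le_univ _
      have hb1 : ((T.image φ).card : ℝ) + 1 ≤ Fintype.card α := by
        exact_mod_cast (Nat.add_le_add_right card_image_le 1).trans hTc
      have hb2 : (((nbIn G T x).biUnion fun y => nbIn K U (φ y)).card : ℝ) ≤
          Δ * (2 * δ * U.card) := by
        calc (((nbIn G T x).biUnion fun y => nbIn K U (φ y)).card : ℝ)
            ≤ ∑ y ∈ nbIn G T x, ((nbIn K U (φ y)).card : ℝ) := by
              exact_mod_cast card_biUnion_le
          _ ≤ (nbIn G T x).card • (2 * δ * (U.card : ℝ)) := by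
              refine Finset.sum_le_card_nsmul _ _ _ fun y hy => ?_
              exact (mem_filter.1 (hφ y (mem_nbIn.1 hy).1)).2
          _ ≤ _ := by
              rw [nsmul_eq_mul]
              refine mul_le_mul_of_nonneg_right ?_ (by positivity)
              exact_mod_cast (card_le_card (nbIn_mono G (subset_univ T) x)).trans (hG x)
      -- Embedded neighbours forbid at most `2Δδ|U| ≤ 49/100 |U|` vertices, while `U'` contains half
      -- of `U`. The remaining hundredth exceeds `|G|`, which is the reason for the factor 101.
      have hlt : bad.card < U'.card := by
        have h1 : (bad.card : ℝ) ≤ (T.image φ).card +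
            ((nbIn G T x).biUnion fun y => nbIn K U (φ y)).card := by
          exact_mod_cast card_union_le _ _
        have h2 : (101 : ℝ) * Fintype.card α ≤ U.card := by exact_mod_cast hU
        have : (bad.card : ℝ) < U'.card := by nlinarith
        exact_mod_cast this
      obtain ⟨v, hv, hvb⟩ := exists_mem_notMem_of_card_lt_card hlt
      rw [hbad, mem_union, not_or] at hvb
      have hne : ∀ y ∈ T, y ≠ x := fun y hy h => hx (h ▸ hy)
      have hnK : ∀ y ∈ T, G.Adj x y → ¬ K.Adj (φ y) v := fun y hy hxy hK => hvb.2
        (mem_biUnion.2 ⟨y, mem_nbIn.2 ⟨hy, hxy⟩, mem_nbIn.2 ⟨(mem_filter.1 hv).1, hK⟩⟩)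
      refine ⟨Function.update φ x v, ?_, ?_, ?_⟩
      · intro y hy
        rcases mem_insert.1 hy with rfl | hy
        · simpa using hv
        · rw [Function.update_of_ne (hne y hy)]; exact hφ y hy
      · intro y hy z hz hyz
        rcases mem_insert.1 (mem_coe.1 hy) with h1 | hy <;>
          rcases mem_insert.1 (mem_coe.1 hz) with h2 | hz
        · rw [h1, h2]
        · rw [h1, Function.update_self, Function.update_of_ne (hne z hz)] at hyz
          exact absurd (mem_image.2 ⟨z, hz, hyz.symm⟩) hvb.1
        · rw [h2, Function.update_self, Function.update_of_ne (hne y hy)] at hyz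
          exact absurd (mem_image.2 ⟨y, hy, hyz⟩) hvb.1
        · rw [Function.update_of_ne (hne y hy), Function.update_of_ne (hne z hz)] at hyz
          exact hinj hy hz hyz
      · intro y hy z hz hyz
        rcases mem_insert.1 hy with h1 | hy' <;> rcases mem_insert.1 hz with h2 | hz'
        · subst h1; subst h2; exact absurd hyz (G.loopless.irrefl _)
        · subst h1
          rw [Function.update_self, Function.update_of_ne (hne z hz')]
          exact fun h => hnK z hz' hyz h.symm
        · subst h2
          rw [Function.update_self, Function.update_of_ne (hne y hy')]
          exact hnK y hy' hyz.symm
        · rw [Function.update_of_ne (hne y hy'), Function.update_of_ne (hne z hz')]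
          exact hadj y hy' z hz' hyz
  obtain ⟨φ, _, hinj, hadj⟩ := key univ
  have hinj' : Function.Injective φ := fun x y h => hinj (by simp) (by simp) h
  refine ⟨⟨⟨φ, fun {x y} h => ?_⟩, hinj'⟩⟩
  rw [SimpleGraph.compl_adj]
  exact ⟨hinj'.ne h.ne, hadj x (mem_univ _) y (mem_univ _) h⟩

/-- Bi-density with an absolute lower bound `m` on the sizes of the two sets. -/
def DenseAbove (K : SimpleGraph V) (γ m : ℝ) (B : Finset V) : Prop :=
  ∀ X ⊆ B, ∀ Y ⊆ B, Disjoint X Y → m ≤ X.card → m ≤ Y.card →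
    γ * X.card * Y.card ≤ edgeCount K X Y

lemma DenseAbove.subset {K : SimpleGraph V} {γ m : ℝ} {B C : Finset V}
    (h : DenseAbove K γ m B) (hC : C ⊆ B) : DenseAbove K γ m C :=
  fun X hX Y hY => h X (hX.trans hC) Y (hY.trans hC)

/-- Every large set contains a large bi-dense subset if the complement of the graph is free of a
fixed bounded-degree graph. -/
lemma exists_denseAbove_subset [Fintype α] [Nonempty α] (K : SimpleGraph V) (G : SimpleGraph α)
    (hK : G.Free Kᶜ) {Δ k h : ℕ} (hΔ : 2 ≤ Δ) (hG : ∀ x, (nbIn G univ x).card ≤ Δ)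
    (hk : Fintype.card α ≤ k) (hh : 8 * Δ ≤ 2 ^ h) {ε : ℝ} (hε : 0 < ε) (hε1 : ε ≤ 1)
    (W : Finset V) (M : ℝ) (hM : 7 * (k : ℝ) ≤ M) (hW : (6 / ε) ^ h * M ≤ W.card) :
    ∃ B ⊆ W, M ≤ B.card ∧ DenseAbove K (1 / (12 * Δ)) (ε * B.card) B := by
  by_contra hcon
  push Not at hcon
  have hΔR : (2 : ℝ) ≤ Δ := by exact_mod_cast hΔ
  obtain ⟨U, _, hUc, hUe⟩ := exists_sparse_subset K (γ := 1 / (12 * Δ)) (by positivity) hε hε1 W M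
    (by
      intro B hB hBM
      have := hcon B hB hBM
      simp only [DenseAbove] at this
      push Not at this
      obtain ⟨X, hX, Y, hY, h1, h2, h3, h4⟩ := this
      exact ⟨X, hX, Y, hY, h1, h2, h3, h4⟩) (7 * k) M le_rfl (by push_cast; exact hM) h W
    subset_rfl hW
  -- The constants fit: `4Δδ` splits as 0.48 from the pair density `1/(12Δ)` and 0.5 from `2⁻ʰ ≤
  -- 1/(8Δ)`, and `2ʰ · 7k ≥ 112k ≥ 101|G|`.
  refine hK (isContained_compl_of_sparse K G hG U (by positivity) ?_ hUe ?_)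
  · have hh' : (8 * Δ : ℝ) ≤ 2 ^ h := by exact_mod_cast hh
    have h1 : (1 : ℝ) / 2 ^ h ≤ 1 / (8 * Δ) := one_div_le_one_div_of_le (by positivity) hh'
    have h2 : 4 * (Δ : ℝ) * (36 / 25 * (1 / (12 * Δ)) + 1 / (8 * Δ)) = 98 / 100 := by
      field_simp; norm_num
    rw [← h2]
    gcongr
  · rw [hUc]
    have : 16 ≤ 2 ^ h := le_trans (by omega) hh
    nlinarith

end Complement

/-! ### Embedding bounded-degree graphs into bi-dense sets. -/

section Embedding

variable {V ι : Type*}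

open Classical in
/-- The candidates `u ∈ C` for the image of `w`, given the images under `φ` of the vertices
in `T`. -/
noncomputable def candidates (K : SimpleGraph V) (F : SimpleGraph ι) (φ : ι → V) (T : Finset ι)
    (C : Finset V) (w : ι) : Finset V :=
  C.filter fun u => ∀ y ∈ T, F.Adj y w → K.Adj (φ y) u

lemma mem_candidates {K : SimpleGraph V} {F : SimpleGraph ι} {φ : ι → V} {T : Finset ι}
    {C : Finset V} {w : ι} {u : V} :
    u ∈ candidates K F φ T C w ↔ u ∈ C ∧ ∀ y ∈ T, F.Adj y w → K.Adj (φ y) u := by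
  classical
  simp [candidates]

/-- A partial embedding of `F` defined on `T` that leaves every other vertex many candidates. -/
def IsPartialEmbedding (K : SimpleGraph V) (F : SimpleGraph ι) (C : ι → Finset V) (θ c : ℝ)
    (T : Finset ι) (φ : ι → V) : Prop :=
  (∀ x ∈ T, φ x ∈ C x) ∧ Set.InjOn φ T ∧ (∀ x ∈ T, ∀ y ∈ T, F.Adj x y → K.Adj (φ x) (φ y)) ∧
    ∀ w ∉ T, θ ^ (nbIn F T w).card * c ≤ (candidates K F φ T (C w) w).card

/-- In a bi-dense set fewer than `m` vertices have few neighbours in a given large set. -/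
lemma card_low_lt_of_denseAbove {K : SimpleGraph V} {γ m : ℝ} {B : Finset V}
    (hγ : 0 ≤ γ) (hm : 0 < m) (hB : DenseAbove K γ m B) {S D : Finset V} (hS : S ⊆ B) (hD : D ⊆ B)
    (hDm : 4 * (m + 1) ≤ D.card)
    (hlow : ∀ u ∈ S, ((nbIn K D u).card : ℝ) < 3 / 4 * γ * D.card) : (S.card : ℝ) < m := by
  classical
  by_contra hcon
  push Not at hcon
  obtain ⟨X, hX, hXc⟩ := exists_subset_card_eq (Nat.ceil_le.2 hcon)
  have hXm : m ≤ X.card := by rw [hXc]; exact Nat.le_ceil m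
  have hXm1 : (X.card : ℝ) < m + 1 := by rw [hXc]; exact Nat.ceil_lt_add_one hm.le
  -- Bi-density speaks only of disjoint sets. Trimming the bad vertices to `⌈m⌉` of them makes their
  -- removal from `D` cost at most a quarter, which is the origin of the factor 3/4.
  have hY : (3 / 4 : ℝ) * D.card ≤ (D \ X).card := by
    have h1 : D.card ≤ (D \ X).card + X.card := by
      have := card_le_card_sdiff_add_card (s := D) (t := X)
      omega
    have h2 : (D.card : ℝ) ≤ (D \ X).card + X.card := by exact_mod_cast h1
    linarith
  have h1 := hB X (hX.trans hS) (D \ X) (sdiff_subset.trans hD) disjoint_sdiff hXm (by linarith)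
  have hne : X.Nonempty := by
    rw [← card_pos]
    have : (0 : ℝ) < X.card := hm.trans_le hXm
    exact_mod_cast this
  have h2 : (edgeCount K X (D \ X) : ℝ) < ∑ _x ∈ X, 3 / 4 * γ * (D.card : ℝ) := by
    rw [edgeCount, Nat.cast_sum]
    refine Finset.sum_lt_sum_of_nonempty hne fun x hx => lt_of_le_of_lt ?_ (hlow x (hX hx))
    exact_mod_cast card_le_card (nbIn_mono K sdiff_subset x)
  rw [Finset.sum_const, nsmul_eq_mul] at h2
  have h3 : (X.card : ℝ) * (3 / 4 * γ * D.card) ≤ γ * X.card * (D \ X).card := by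
    have : (0 : ℝ) ≤ γ * X.card := by positivity
    nlinarith
  linarith

/-- Each unembedded neighbour `w` of `x` excludes fewer than `m` images of `x`, namely those with
too few neighbours among the candidates of `w`. Avoiding these, and the images already used, leaves
a choice that shrinks every affected candidate set by a factor of at least `3/4 γ`. Only neighbours
embedded before a vertex shrink its candidate set, so `b` may be much smaller than the maximum
degree `a`. -/
lemma exists_extension [DecidableEq ι] {K : SimpleGraph V} {F : SimpleGraph ι} [Fintype ι]
    {γ m c : ℝ} {a b : ℕ}
    (hγ : 0 < γ) (hγ1 : γ ≤ 1) (hm : 0 < m) (hc : 0 ≤ c) {B : Finset V}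
    (hB : DenseAbove K γ m B) {C : ι → Finset V} (hCB : ∀ x, C x ⊆ B)
    (ha : ∀ x, (nbIn F univ x).card ≤ a)
    (h1 : 4 * (m + 1) ≤ (3 / 4 * γ) ^ b * c)
    (h2 : Fintype.card ι + a * m ≤ (3 / 4 * γ) ^ b * c)
    {T : Finset ι} {x : ι} (hx : x ∉ T) (hT : ∀ w ∉ T, (nbIn F T w).card ≤ b) {φ : ι → V}
    (hφ : IsPartialEmbedding K F C (3 / 4 * γ) c T φ) :
    ∃ ψ, IsPartialEmbedding K F C (3 / 4 * γ) c (insert x T) ψ := by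
  classical
  obtain ⟨hφC, hinj, hadj, hcand⟩ := hφ
  set θ : ℝ := 3 / 4 * γ with hθ
  have hθ0 : 0 < θ := by positivity
  have hθ1 : θ ≤ 1 := by linarith
  have hlarge : ∀ w ∉ T, θ ^ b * c ≤ (candidates K F φ T (C w) w).card := fun w hw =>
    (mul_le_mul_of_nonneg_right (pow_le_pow_of_le_one hθ0.le hθ1 (hT w hw)) hc).trans (hcand w hw)
  set D : ι → Finset V := fun w => candidates K F φ T (C w) w with hDdef
  have hDB : ∀ w, D w ⊆ B := fun w u hu => hCB w (mem_candidates.1 hu).1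
  set low : ι → Finset V := fun w =>
    (D x).filter fun u => ((nbIn K (D w) u).card : ℝ) < θ * (D w).card with hlowdef
  have hlow : ∀ w ∉ T, ((low w).card : ℝ) < m := fun w hw =>
    card_low_lt_of_denseAbove hγ.le hm hB ((filter_subset _ _).trans (hDB x)) (hDB w)
      (h1.trans (hlarge w hw)) fun u hu => (mem_filter.1 hu).2
  set bad := T.image φ ∪ ((nbIn F univ x) \ T).biUnion low with hbad
  have hbadc : bad.card < (D x).card := by
    have e1 : (bad.card : ℝ) ≤ (T.image φ).card + (((nbIn F univ x) \ T).biUnion low).card := by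
      exact_mod_cast card_union_le _ _
    have e2 : ((T.image φ).card : ℝ) + 1 ≤ Fintype.card ι := by
      have : T.card + 1 ≤ Fintype.card ι := by
        rw [← card_insert_of_notMem hx]; exact card_le_univ _
      exact_mod_cast (Nat.add_le_add_right card_image_le 1).trans this
    have e3 : ((((nbIn F univ x) \ T).biUnion low).card : ℝ) ≤ a * m := by
      calc ((((nbIn F univ x) \ T).biUnion low).card : ℝ)
          ≤ ∑ w ∈ (nbIn F univ x) \ T, ((low w).card : ℝ) := by exact_mod_cast card_biUnion_le
        _ ≤ ((nbIn F univ x) \ T).card • m :=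
            Finset.sum_le_card_nsmul _ _ _ fun w hw => (hlow w (mem_sdiff.1 hw).2).le
        _ ≤ _ := by
            rw [nsmul_eq_mul]
            refine mul_le_mul_of_nonneg_right ?_ hm.le
            exact_mod_cast (card_le_card sdiff_subset).trans (ha x)
    have e4 := hlarge x hx
    have : (bad.card : ℝ) < (D x).card := by linarith
    exact_mod_cast this
  obtain ⟨v, hv, hvb⟩ := exists_mem_notMem_of_card_lt_card hbadc
  rw [hbad, mem_union, not_or] at hvb
  have hne : ∀ y ∈ T, y ≠ x := fun y hy h => hx (h ▸ hy)
  have hup : ∀ y ∈ T, Function.update φ x v y = φ y := fun y hy =>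
    Function.update_of_ne (hne y hy) _ _
  have hvD := mem_candidates.1 hv
  refine ⟨Function.update φ x v, ?_, ?_, ?_, ?_⟩
  · intro y hy
    rcases mem_insert.1 hy with rfl | hy
    · simpa using hvD.1
    · rw [hup y hy]; exact hφC y hy
  · intro y hy z hz hyz
    rcases mem_insert.1 (mem_coe.1 hy) with h1 | hy' <;>
      rcases mem_insert.1 (mem_coe.1 hz) with h2 | hz'
    · rw [h1, h2]
    · rw [h1, Function.update_self, hup z hz'] at hyz
      exact absurd (mem_image.2 ⟨z, hz', hyz.symm⟩) hvb.1
    · rw [h2, Function.update_self, hup y hy'] at hyz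
      exact absurd (mem_image.2 ⟨y, hy', hyz⟩) hvb.1
    · rw [hup y hy', hup z hz'] at hyz
      exact hinj hy' hz' hyz
  · intro y hy z hz hyz
    rcases mem_insert.1 hy with h1 | hy' <;> rcases mem_insert.1 hz with h2 | hz'
    · rw [h1, h2] at hyz; exact absurd hyz (F.loopless.irrefl _)
    · rw [h1, Function.update_self, hup z hz']
      exact (hvD.2 z hz' (h1 ▸ hyz.symm)).symm
    · rw [h2, Function.update_self, hup y hy']
      exact hvD.2 y hy' (h2 ▸ hyz)
    · rw [hup y hy', hup z hz']
      exact hadj y hy' z hz' hyz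
  · intro w hw
    rw [mem_insert, not_or] at hw
    by_cases hxw : F.Adj x w
    · have hc1 : (nbIn F (insert x T) w).card = (nbIn F T w).card + 1 := by
        rw [← card_insert_of_notMem (a := x) (s := nbIn F T w)
          (fun h => hx (mem_nbIn.1 h).1)]
        congr 1
        ext y
        simp only [mem_nbIn, mem_insert]
        constructor
        · rintro ⟨rfl | h, h'⟩
          · exact Or.inl rfl
          · exact Or.inr ⟨h, h'⟩
        · rintro (rfl | ⟨h, h'⟩)
          · exact ⟨Or.inl rfl, hxw.symm⟩
          · exact ⟨Or.inr h, h'⟩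
      have hc2 : candidates K F (Function.update φ x v) (insert x T) (C w) w = nbIn K (D w) v := by
        ext u
        simp only [mem_candidates, mem_nbIn, hDdef, mem_insert, forall_eq_or_imp,
          Function.update_self]
        constructor
        · rintro ⟨hu, hvu, hT'⟩
          exact ⟨⟨hu, fun y hy hyw => by have := hT' y hy hyw; rwa [hup y hy] at this⟩, hvu hxw⟩
        · rintro ⟨⟨hu, hT'⟩, hvu⟩
          exact ⟨hu, fun _ => hvu, fun y hy hyw => by rw [hup y hy]; exact hT' y hy hyw⟩
      have hvlow : v ∉ low w := fun h => hvb.2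
        (mem_biUnion.2 ⟨w, mem_sdiff.2 ⟨mem_nbIn.2 ⟨mem_univ _, hxw⟩, hw.2⟩, h⟩)
      have hge : θ * (D w).card ≤ (nbIn K (D w) v).card := by
        by_contra hlt
        exact hvlow (mem_filter.2 ⟨hv, not_le.1 hlt⟩)
      rw [hc1, hc2, pow_succ]
      calc θ ^ (nbIn F T w).card * θ * c = θ * (θ ^ (nbIn F T w).card * c) := by ring
        _ ≤ θ * (D w).card := mul_le_mul_of_nonneg_left (hcand w hw.2) hθ0.le
        _ ≤ _ := hge
    · have hc1 : nbIn F (insert x T) w = nbIn F T w := by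
        ext y
        simp only [mem_nbIn, mem_insert]
        constructor
        · rintro ⟨rfl | h, h'⟩
          · exact absurd h'.symm hxw
          · exact ⟨h, h'⟩
        · exact fun h => ⟨Or.inr h.1, h.2⟩
      have hc2 : candidates K F (Function.update φ x v) (insert x T) (C w) w = D w := by
        ext u
        simp only [mem_candidates, hDdef, mem_insert, forall_eq_or_imp, Function.update_self]
        constructor
        · rintro ⟨hu, _, hT'⟩
          exact ⟨hu, fun y hy hyw => by have := hT' y hy hyw; rwa [hup y hy] at this⟩
        · rintro ⟨hu, hT'⟩
          exact ⟨hu, fun h => absurd h hxw,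
            fun y hy hyw => by rw [hup y hy]; exact hT' y hy hyw⟩
      rw [hc1, hc2]
      exact hcand w hw.2

/-- Embedding of bounded-degree graphs with prescribed candidate sets into a bi-dense set. The
vertices in the independent set `Z` are embedded first, so that their degrees do not enter the
exponent `b`. -/
theorem exists_embedding_of_denseAbove [Fintype ι] {K : SimpleGraph V} {F : SimpleGraph ι}
    {γ m c : ℝ} {a b : ℕ}
    (hγ : 0 < γ) (hγ1 : γ ≤ 1) (hm : 0 < m) {B : Finset V}
    (hB : DenseAbove K γ m B) {C : ι → Finset V} (hCB : ∀ x, C x ⊆ B)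
    (hCc : ∀ x, c ≤ (C x).card) (Z : Finset ι) (hZ : ∀ x ∈ Z, ∀ y ∈ Z, ¬ F.Adj x y)
    (ha : ∀ x, (nbIn F univ x).card ≤ a) (hb : ∀ x ∉ Z, (nbIn F univ x).card ≤ b)
    (h1 : 4 * (m + 1) ≤ (3 / 4 * γ) ^ b * c)
    (h2 : Fintype.card ι + a * m ≤ (3 / 4 * γ) ^ b * c) :
    ∃ φ : ι → V, (∀ x, φ x ∈ C x) ∧ Function.Injective φ ∧
      ∀ x y, F.Adj x y → K.Adj (φ x) (φ y) := by
  classical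
  have hc : 0 < c := by
    have h3 : (0 : ℝ) < (3 / 4 * γ) ^ b := by positivity
    exact (pos_iff_pos_of_mul_pos (by linarith)).1 h3
  have hθ0 : (0 : ℝ) < 3 / 4 * γ := by positivity
  have hne : Nonempty (ι → V) :=
    ⟨fun x => (card_pos.1 (by exact_mod_cast hc.trans_le (hCc x) : 0 < (C x).card)).choose⟩
  have hfirst : ∀ T : Finset ι, T ⊆ Z →
      ∃ φ, IsPartialEmbedding K F C (3 / 4 * γ) c T φ := by
    intro T
    induction T using Finset.induction_on with
    | empty =>
      intro _
      refine ⟨Classical.choice hne, by simp, by simp, by simp, fun w _ => ?_⟩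
      have e1 : nbIn F ∅ w = ∅ := subset_empty.1 (nbIn_subset _ _ _)
      have e2 : candidates K F (Classical.choice hne) ∅ (C w) w = C w := by
        ext; simp [mem_candidates]
      rw [e1, e2]
      simpa using hCc w
    | insert x T hx ih =>
      intro hT
      obtain ⟨φ, hφ⟩ := ih ((subset_insert x T).trans hT)
      refine exists_extension hγ hγ1 hm hc.le hB hCB ha h1 h2 hx (fun w hw => ?_) hφ
      -- During this stage a vertex of `Z` has no embedded neighbours at all, so its possibly large
      -- degree is harmless.
      by_cases hwZ : w ∈ Z
      · have : nbIn F T w = ∅ := by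
          refine eq_empty_of_forall_notMem fun y hy => ?_
          exact hZ w hwZ y (hT (mem_insert_of_mem (mem_nbIn.1 hy).1)) (mem_nbIn.1 hy).2
        simp [this]
      · exact (card_le_card (nbIn_mono F (subset_univ T) w)).trans (hb w hwZ)
  have hsecond : ∀ T : Finset ι, ∃ φ, IsPartialEmbedding K F C (3 / 4 * γ) c (T ∪ Z) φ := by
    intro T
    induction T using Finset.induction_on with
    | empty => simpa using hfirst Z subset_rfl
    | insert x T _ ih =>
      obtain ⟨φ, hφ⟩ := ih
      rw [insert_union]
      by_cases hx : x ∈ T ∪ Z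
      · rw [insert_eq_of_mem hx]; exact ⟨φ, hφ⟩
      · refine exists_extension hγ hγ1 hm hc.le hB hCB ha h1 h2 hx (fun w hw => ?_) hφ
        exact (card_le_card (nbIn_mono F (subset_univ _) w)).trans
          (hb w fun h => hw (mem_union_right _ h))
  obtain ⟨φ, h3, h4, h5, _⟩ := hsecond univ
  have hu : univ ∪ Z = univ := by ext; simp
  rw [hu] at h3 h4 h5
  exact ⟨φ, fun x => h3 x (mem_univ x), fun x y h => h4 (by simp) (by simp) h,
    fun x y => h5 x (mem_univ x) y (mem_univ y)⟩

end Embedding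

/-! ### An upper bound for the Ramsey number. -/

section RamseyBound

variable {α β : Type*} [Fintype α] [Fintype β]

/-- The bound of Graham, Rödl and Ruciński for Ramsey numbers of bounded-degree graphs. -/
theorem ramsey_le [Nonempty α] (G : SimpleGraph α) (H : SimpleGraph β) {Δ k h : ℕ} (hΔ : 2 ≤ Δ)
    (hG : ∀ x, (nbIn G univ x).card ≤ Δ) (hH : ∀ x, (nbIn H univ x).card ≤ Δ)
    (hα : Fintype.card α ≤ k) (hβ : Fintype.card β ≤ k) (hh : 8 * Δ ≤ 2 ^ h) :
    ramsey G H ≤ (48 * Δ * (16 * Δ) ^ Δ) ^ h * (16 * k * Δ * (16 * Δ) ^ Δ) := by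
  classical
  refine Nat.sInf_le ?_
  intro C
  by_cases hC : G.IsContained C
  · exact Or.inl hC
  refine Or.inr ?_
  have hΔR : (2 : ℝ) ≤ Δ := by exact_mod_cast hΔ
  have hk : (1 : ℝ) ≤ k := by
    have := Fintype.card_pos (α := α)
    exact_mod_cast (by omega : 1 ≤ k)
  have hT : (1 : ℝ) ≤ (16 * Δ) ^ Δ := one_le_pow₀ (by linarith)
  obtain ⟨B, -, hBM, hB⟩ := exists_denseAbove_subset (Cᶜ) G
    (by rw [compl_compl]; exact hC) hΔ hG hα hh
    (ε := 1 / (8 * Δ * (16 * Δ) ^ Δ)) (by positivity)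
    (by
      rw [div_le_one (by positivity)]
      nlinarith) univ (16 * k * Δ * (16 * Δ) ^ Δ)
    (by
      have : (1 : ℝ) ≤ Δ * (16 * Δ) ^ Δ := by nlinarith
      nlinarith)
    (by
      have : (6 : ℝ) / (1 / (8 * Δ * (16 * Δ) ^ Δ)) = 48 * Δ * (16 * Δ) ^ Δ := by
        field_simp; norm_num
      rw [this, card_univ, Fintype.card_fin]
      push_cast
      exact le_rfl)
  have hθ : (3 / 4 * (1 / (12 * Δ)) : ℝ) = 1 / (16 * Δ) := by field_simp; norm_num
  have hQ : 16 * k * Δ ≤ (1 / (16 * Δ) : ℝ) ^ Δ * B.card := by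
    rw [div_pow, one_pow, one_div_mul_eq_div, le_div_iff₀ (by positivity)]
    exact hBM
  -- `Q` is the guaranteed size of a candidate set after `Δ` shrinkings. The choice of `ε` makes the
  -- bi-density threshold `Q / (8Δ)`, so excluded images take only an eighth of `Q`.
  set Q : ℝ := (1 / (16 * Δ) : ℝ) ^ Δ * B.card with hQdef
  have hm : 1 / (8 * Δ * (16 * Δ) ^ Δ) * (B.card : ℝ) = Q / (8 * Δ) := by
    rw [hQdef, div_pow, one_pow]; field_simp
  have hkΔ : (2 : ℝ) ≤ k * Δ := by nlinarith
  have hQ' : 16 * (k * Δ) ≤ Q := by linarith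
  have hkk : (k : ℝ) ≤ k * Δ := by nlinarith
  have hQpos : 0 < Q := by linarith
  have hQΔ : Q / (8 * Δ) ≤ Q / 16 := by gcongr; linarith
  rw [hm] at hB
  obtain ⟨φ, -, hinj, hadj⟩ := exists_embedding_of_denseAbove (K := Cᶜ) (F := H)
    (γ := 1 / (12 * Δ)) (m := Q / (8 * Δ)) (c := B.card) (a := Δ) (b := Δ)
    (by positivity) (by rw [div_le_one (by positivity)]; linarith) (by positivity) hB
    (C := fun _ => B) (fun _ => subset_rfl) (fun _ => le_rfl) ∅ (by simp) hH
    (fun x _ => hH x) (by rw [hθ, ← hQdef]; linarith)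
    (by
      rw [hθ, ← hQdef]
      have h1 : (Fintype.card β : ℝ) ≤ k := by exact_mod_cast hβ
      have h2 : (Δ : ℝ) * (Q / (8 * Δ)) = Q / 8 := by field_simp
      linarith)
  exact ⟨⟨⟨φ, fun {x y} h => hadj x y h⟩, hinj⟩⟩

end RamseyBound

/-! ### Distance-three sets and proper colourings. -/

section BoundedDegree

variable {β : Type*} [Fintype β]

/-- A graph of maximum degree `Δ` has a set of vertices pairwise at distance at least three that
has at least a `1 / (Δ² + 1)` fraction of the vertices. -/
lemma exists_two_independent (H : SimpleGraph β) {Δ : ℕ}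
    (hH : ∀ x, (nbIn H univ x).card ≤ Δ) :
    ∃ I : Finset β, (∀ x ∈ I, ∀ y ∈ I, ¬ H.Adj x y) ∧
      (∀ z, ∀ x ∈ I, ∀ y ∈ I, H.Adj z x → H.Adj z y → x = y) ∧
      Fintype.card β ≤ I.card * (Δ ^ 2 + 1) := by
  classical
  set P : Finset β → Prop := fun I => (∀ x ∈ I, ∀ y ∈ I, ¬ H.Adj x y) ∧
      (∀ z, ∀ x ∈ I, ∀ y ∈ I, H.Adj z x → H.Adj z y → x = y) with hP
  obtain ⟨I, hI, hmax⟩ := exists_max_image (univ.filter P) card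
    ⟨∅, mem_filter.2 ⟨mem_univ _, by simp, by simp⟩⟩
  have hIP := (mem_filter.1 hI).2
  refine ⟨I, hIP.1, hIP.2, ?_⟩
  -- The balls of radius two around a maximal `I` cover everything. Each neighbour `y` of the centre
  -- accounts for itself and at most `Δ - 1` further vertices, so a ball has at most `1 + Δ²`
  -- elements.
  set ball : β → Finset β := fun x =>
    insert x ((nbIn H univ x).biUnion fun y => insert y ((nbIn H univ y).erase x)) with hball
  have hballc : ∀ x, (ball x).card ≤ Δ ^ 2 + 1 := by
    intro x
    refine (card_insert_le _ _).trans (Nat.add_le_add_right ?_ 1)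
    calc _ ≤ ∑ y ∈ nbIn H univ x, (insert y ((nbIn H univ y).erase x)).card := card_biUnion_le
      _ ≤ (nbIn H univ x).card • Δ := by
          refine Finset.sum_le_card_nsmul _ _ _ fun y hy => ?_
          refine (card_insert_le _ _).trans ?_
          rw [card_erase_of_mem (mem_nbIn.2 ⟨mem_univ _, (mem_nbIn.1 hy).2.symm⟩)]
          have : 0 < (nbIn H univ y).card :=
            card_pos.2 ⟨x, mem_nbIn.2 ⟨mem_univ _, (mem_nbIn.1 hy).2.symm⟩⟩
          have := hH y
          omega
      _ ≤ Δ ^ 2 := by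
          rw [smul_eq_mul, sq]
          exact Nat.mul_le_mul_right _ (hH x)
  have hcov : (univ : Finset β) ⊆ I.biUnion ball := by
    intro z _
    by_contra hz
    have hz' : ∀ x ∈ I, z ∉ ball x := fun x hx h => hz (mem_biUnion.2 ⟨x, hx, h⟩)
    have hzI : z ∉ I := fun h => hz' z h (mem_insert_self _ _)
    have hn1 : ∀ x ∈ I, ¬ H.Adj x z := fun x hx h => hz' x hx
      (mem_insert_of_mem (mem_biUnion.2 ⟨z, mem_nbIn.2 ⟨mem_univ _, h⟩, mem_insert_self _ _⟩))
    have hn2 : ∀ x ∈ I, ∀ y, H.Adj x y → ¬ H.Adj y z := fun x hx y hxy hyz => hz' x hx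
      (mem_insert_of_mem (mem_biUnion.2 ⟨y, mem_nbIn.2 ⟨mem_univ _, hxy⟩, mem_insert_of_mem
        (mem_erase.2 ⟨fun h => hzI (h ▸ hx), mem_nbIn.2 ⟨mem_univ _, hyz⟩⟩)⟩))
    have hins : P (insert z I) := by
      refine ⟨fun x hx y hy hxy => ?_, fun w x hx y hy hwx hwy => ?_⟩
      · rcases mem_insert.1 hx with h1 | hx' <;> rcases mem_insert.1 hy with h2 | hy'
        · rw [h1, h2] at hxy; exact H.loopless.irrefl _ hxy
        · exact hn1 y hy' (h1 ▸ hxy.symm)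
        · exact hn1 x hx' (h2 ▸ hxy)
        · exact hIP.1 x hx' y hy' hxy
      · rcases mem_insert.1 hx with h1 | hx' <;> rcases mem_insert.1 hy with h2 | hy'
        · rw [h1, h2]
        · exact absurd (h1 ▸ hwx) (hn2 y hy' w hwy.symm)
        · exact absurd (h2 ▸ hwy) (hn2 x hx' w hwx.symm)
        · exact hIP.2 w x hx' y hy' hwx hwy
    have := hmax _ (mem_filter.2 ⟨mem_univ _, hins⟩)
    rw [card_insert_of_notMem hzI] at this
    omega
  calc Fintype.card β = (univ : Finset β).card := rfl
    _ ≤ _ := card_le_card hcov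
    _ ≤ ∑ x ∈ I, (ball x).card := card_biUnion_le
    _ ≤ I.card • (Δ ^ 2 + 1) := Finset.sum_le_card_nsmul _ _ _ fun x _ => hballc x
    _ = _ := by rw [smul_eq_mul]

lemma exists_coloring_of_degree_le (G : SimpleGraph β) {Δ : ℕ}
    (hG : ∀ x, (nbIn G univ x).card ≤ Δ) :
    ∃ col : β → ℕ, (∀ x, col x < Δ + 1) ∧ ∀ x y, G.Adj x y → col x ≠ col y := by
  classical
  have key : ∀ T : Finset β, ∃ col : β → ℕ, (∀ x, col x < Δ + 1) ∧
      ∀ x ∈ T, ∀ y ∈ T, G.Adj x y → col x ≠ col y := by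
    intro T
    induction T using Finset.induction_on with
    | empty => exact ⟨fun _ => 0, fun _ => Nat.succ_pos _, by simp⟩
    | insert x T hx ih =>
      obtain ⟨col, hlt, hcol⟩ := ih
      have hc : ((nbIn G univ x).image col).card < (range (Δ + 1)).card := by
        rw [card_range]
        exact (card_image_le.trans (hG x)).trans_lt (Nat.lt_succ_self _)
      obtain ⟨c, hc, hcn⟩ := exists_mem_notMem_of_card_lt_card hc
      have hne : ∀ y ∈ T, y ≠ x := fun y hy h => hx (h ▸ hy)
      have hcy : ∀ y, G.Adj x y → c ≠ col y := fun y hy h =>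
        hcn (mem_image.2 ⟨y, mem_nbIn.2 ⟨mem_univ _, hy⟩, h.symm⟩)
      refine ⟨Function.update col x c, fun y => ?_, fun y hy z hz hyz => ?_⟩
      · by_cases h : y = x
        · rw [h, Function.update_self]; exact mem_range.1 hc
        · rw [Function.update_of_ne h]; exact hlt y
      · rcases mem_insert.1 hy with h1 | hy' <;> rcases mem_insert.1 hz with h2 | hz'
        · rw [h1, h2] at hyz; exact absurd hyz (G.loopless.irrefl _)
        · rw [h1, Function.update_self, Function.update_of_ne (hne z hz')]
          exact hcy z (h1 ▸ hyz)
        · rw [h2, Function.update_self, Function.update_of_ne (hne y hy')]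
          exact (hcy y (h2 ▸ hyz.symm)).symm
        · rw [Function.update_of_ne (hne y hy'), Function.update_of_ne (hne z hz')]
          exact hcol y hy' z hz' hyz
  obtain ⟨col, h1, h2⟩ := key univ
  exact ⟨col, h1, fun x y => h2 x (mem_univ x) y (mem_univ y)⟩

end BoundedDegree

/-! ### Finding many vertices of high degree into some absorber. -/

section HighDegree

variable {V α : Type*} [Fintype α]

/-- If every large set of vertices contains a pair `(Y, A)` with property `P`, then for some such
pair there are many vertices outside `A` of high degree into `Y`: otherwise one embeds `G` in the
complement one colour class at a time. -/
lemma exists_many_high_degree (K : SimpleGraph V) (G : SimpleGraph α) (hK : G.Free Kᶜ)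
    {Δ : ℕ} (hG : ∀ x, (nbIn G univ x).card ≤ Δ) {θ : ℝ} (hθ : 0 ≤ θ) (hθΔ : Δ * θ ≤ 1 / 2)
    (P : Finset V → Finset V → Prop) {w₀ N₀ : ℝ} (hw₀ : w₀ ≤ N₀) (hw0 : 0 ≤ w₀)
    (hP : ∀ W : Finset V, w₀ ≤ W.card → ∃ Y A, Y ⊆ A ∧ A ⊆ W ∧ (A.card : ℝ) ≤ w₀ ∧
      2 * Fintype.card α ≤ Y.card ∧ P Y A)
    (W : Finset V) (hW : 4 ^ (Δ + 1) * N₀ ≤ W.card) :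
    ∃ Y A X₀, P Y A ∧ (A.card : ℝ) ≤ w₀ ∧ X₀ ⊆ W ∧ Disjoint X₀ A ∧ N₀ ≤ X₀.card ∧
      ∀ v ∈ X₀, θ * Y.card ≤ (nbIn K Y v).card := by
  classical
  by_contra hcon
  push Not at hcon
  obtain ⟨col, hcol, hproper⟩ := exists_coloring_of_degree_le G hG
  have hN0 : 0 ≤ N₀ := hw0.trans hw₀
  have hVne : Nonempty (α → V) := by
    by_cases hα : IsEmpty α
    · exact ⟨fun x => (hα.false x).elim⟩
    · rw [not_isEmpty_iff] at hα
      obtain ⟨Y, A, hYA, -, -, hY, -⟩ := hP W (by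
        refine hw₀.trans (le_trans ?_ hW)
        have : (1 : ℝ) ≤ 4 ^ (Δ + 1) := one_le_pow₀ (by norm_num)
        nlinarith)
      have := Fintype.card_pos (α := α)
      obtain ⟨v, _⟩ := card_pos.1 (by omega : 0 < Y.card)
      exact ⟨fun _ => v⟩
  -- The last colour is reserved first: a set `Y` is set aside for colour `j`, and all earlier
  -- colours are then embedded among vertices of low degree into `Y`.
  have key : ∀ j : ℕ, ∀ W' ⊆ W, 4 ^ j * N₀ ≤ W'.card → ∃ φ : α → V,
      (∀ x, col x < j → φ x ∈ W') ∧ (∀ x y, col x < j → col y < j → φ x = φ y → x = y) ∧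
      ∀ x y, col x < j → col y < j → G.Adj x y → ¬ K.Adj (φ x) (φ y) := by
    intro j
    induction j with
    | zero => intro W' _ _; exact ⟨Classical.choice hVne, by simp, by simp, by simp⟩
    | succ j ih =>
      intro W' hW' hc
      have h4 : (1 : ℝ) ≤ 4 ^ j := one_le_pow₀ (by norm_num)
      have h4N : N₀ ≤ 4 ^ j * N₀ := by nlinarith
      rw [pow_succ] at hc
      obtain ⟨Y, A, hYA, hAW, hAc, hYc, hPYA⟩ := hP W' (by linarith)
      set p : V → Prop := fun v => θ * Y.card ≤ (nbIn K Y v).card with hp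
      have hHi : (((W' \ A).filter p).card : ℝ) < N₀ := by
        by_contra hge
        push Not at hge
        obtain ⟨v, hv, hlt⟩ := hcon Y A ((W' \ A).filter p) hPYA hAc
          ((filter_subset _ _).trans (sdiff_subset.trans hW'))
          (disjoint_of_subset_left (filter_subset _ _) sdiff_disjoint) hge
        exact absurd (mem_filter.1 hv).2 (not_le.2 hlt)
      -- The losses are `|A| ≤ w₀ ≤ N₀` and fewer than `N₀` high-degree vertices, well within the
      -- factor 4 available.
      have hLo : 4 ^ j * N₀ ≤ ((W' \ A).filter fun v => ¬ p v).card := by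
        have e1 : (((W' \ A).filter p).card : ℝ) + ((W' \ A).filter fun v => ¬ p v).card =
            (W' \ A).card := by
          exact_mod_cast Finset.card_filter_add_card_filter_not (s := W' \ A) p
        have e2 : (W'.card : ℝ) ≤ (W' \ A).card + A.card := by
          exact_mod_cast card_le_card_sdiff_add_card
        nlinarith
      obtain ⟨φ, hφ, hinj, hadj⟩ := ih _ ((filter_subset _ _).trans (sdiff_subset.trans hW')) hLo
      set avail : α → Finset V := fun x =>
        Y \ (univ.filter fun y => G.Adj x y ∧ col y < j).biUnion fun y => nbIn K Y (φ y) with hav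
      have havc : ∀ x, Fintype.card α ≤ (avail x).card := by
        intro x
        have e1 : (((univ.filter fun y => G.Adj x y ∧ col y < j).biUnion
            fun y => nbIn K Y (φ y)).card : ℝ) ≤ Δ * (θ * Y.card) := by
          calc _ ≤ ∑ y ∈ univ.filter (fun y => G.Adj x y ∧ col y < j),
                ((nbIn K Y (φ y)).card : ℝ) := by exact_mod_cast card_biUnion_le
            _ ≤ (univ.filter fun y => G.Adj x y ∧ col y < j).card • (θ * (Y.card : ℝ)) := by
                refine Finset.sum_le_card_nsmul _ _ _ fun y hy => ?_
                exact (not_le.1 (mem_filter.1 (hφ y (mem_filter.1 hy).2.2)).2).le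
            _ ≤ _ := by
                rw [nsmul_eq_mul]
                refine mul_le_mul_of_nonneg_right ?_ (by positivity)
                refine Nat.cast_le.2 ((card_le_card fun y hy => ?_).trans (hG x))
                exact mem_nbIn.2 ⟨mem_univ _, (mem_filter.1 hy).2.1⟩
        have e2 : (Y.card : ℝ) ≤ (avail x).card + ((univ.filter fun y => G.Adj x y ∧
            col y < j).biUnion fun y => nbIn K Y (φ y)).card := by
          exact_mod_cast card_le_card_sdiff_add_card
        have e3 : (2 : ℝ) * Fintype.card α ≤ Y.card := by exact_mod_cast hYc
        have e4 : Δ * (θ * Y.card) ≤ 1 / 2 * (Y.card : ℝ) := by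
          rw [← mul_assoc]
          exact mul_le_mul_of_nonneg_right hθΔ (Nat.cast_nonneg _)
        have : (Fintype.card α : ℝ) ≤ (avail x).card := by linarith
        exact_mod_cast this
      -- At most half of `Y` is forbidden to each vertex, so each list has at least `|G|` elements
      -- and Hall's condition is immediate. The map `f` is defined on all of `G` but used only on
      -- colour `j`.
      obtain ⟨f, hf, hfa⟩ := (Finset.all_card_le_biUnion_card_iff_exists_injective avail).1 (by
        intro s
        rcases s.eq_empty_or_nonempty with rfl | ⟨x, hx⟩
        · simp
        · exact (card_le_univ s).trans ((havc x).trans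
            (card_le_card (subset_biUnion_of_mem avail hx))))
      have hfY : ∀ x, f x ∈ Y := fun x => (mem_sdiff.1 (hfa x)).1
      have hdis : ∀ x y, col y < j → f x ≠ φ y := fun x y hy h => by
        have h1 := (mem_sdiff.1 (mem_filter.1 (hφ y hy)).1).2
        exact h1 (h ▸ hYA (hfY x))
      have hnadj : ∀ x y, col y < j → G.Adj x y → ¬ K.Adj (φ y) (f x) := fun x y hy hxy hKa =>
        (mem_sdiff.1 (hfa x)).2 (mem_biUnion.2 ⟨y, mem_filter.2 ⟨mem_univ _, hxy, hy⟩,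
          mem_nbIn.2 ⟨hfY x, hKa⟩⟩)
      refine ⟨fun x => if col x < j then φ x else f x, fun x hx => ?_, fun x y hx hy hxy => ?_,
        fun x y hx hy hxy => ?_⟩
      · dsimp only
        split_ifs with h
        · exact (mem_sdiff.1 (mem_filter.1 (hφ x h)).1).1
        · exact hAW (hYA (hfY x))
      · dsimp only at hxy
        split_ifs at hxy with h1 h2 h2
        · exact hinj x y h1 h2 hxy
        · exact absurd hxy.symm (hdis y x h1)
        · exact absurd hxy (hdis x y h2)
        · exact hf hxy
      · dsimp only
        split_ifs with h1 h2 h2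
        · exact hadj x y h1 h2 hxy
        · exact hnadj y x h1 hxy.symm
        · exact fun h => hnadj x y h2 hxy h.symm
        · exact absurd (by omega) (hproper x y hxy)
  obtain ⟨φ, -, hinj, hadj⟩ := key (Δ + 1) W subset_rfl hW
  have hinj' : Function.Injective φ := fun x y h => hinj x y (hcol x) (hcol y) h
  refine hK ⟨⟨⟨φ, fun {x y} h => ?_⟩, hinj'⟩⟩
  rw [SimpleGraph.compl_adj]
  exact ⟨hinj'.ne h.ne, hadj x y (hcol x) (hcol y) h⟩

end HighDegree

/-! ### Random permutations expand. -/

section Expander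

lemma descFactorial_mul_pow_le {c n : ℕ} (h : c ≤ n) (a : ℕ) :
    c.descFactorial a * n ^ a ≤ n.descFactorial a * c ^ a := by
  induction a with
  | zero => simp
  | succ a ih =>
    rw [Nat.descFactorial_succ, Nat.descFactorial_succ, pow_succ, pow_succ]
    have h1 : (c - a) * n ≤ (n - a) * c := by
      rw [Nat.sub_mul, Nat.sub_mul, Nat.mul_comm c n]
      exact Nat.sub_le_sub_left (Nat.mul_le_mul_left a h) _
    calc (c - a) * c.descFactorial a * (n ^ a * n)
        = ((c - a) * n) * (c.descFactorial a * n ^ a) := by ring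
      _ ≤ ((n - a) * c) * (n.descFactorial a * c ^ a) := Nat.mul_le_mul h1 ih
      _ = _ := by ring

/-- The number of permutations that map `A` into `C`. -/
lemma card_perm_mapsTo_le {n : ℕ} (A C : Finset (Fin n)) :
    (univ.filter fun σ : Equiv.Perm (Fin n) => ∀ x ∈ A, σ x ∈ C).card ≤
      (n - A.card).factorial * C.card.descFactorial A.card := by
  classical
  set s := univ.filter fun σ : Equiv.Perm (Fin n) => ∀ x ∈ A, σ x ∈ C with hs
  set f : Equiv.Perm (Fin n) → (A → Fin n) := fun σ x => σ x with hf
  have himg : (s.image f).card ≤ C.card.descFactorial A.card := by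
    have hcard : (univ : Finset (A ↪ C)).card = C.card.descFactorial A.card := by
      rw [card_univ, Fintype.card_embedding_eq]; simp
    rw [← hcard]
    refine (card_le_card (t := univ.image fun (g : A ↪ C) (x : A) => ((g x : C) : Fin n)) ?_).trans
      card_image_le
    intro g hg
    obtain ⟨σ, hσ, rfl⟩ := mem_image.1 hg
    refine mem_image.2 ⟨⟨fun x => ⟨σ x, (mem_filter.1 hσ).2 x x.2⟩, fun x y h => ?_⟩,
      mem_univ _, rfl⟩
    exact Subtype.ext (σ.injective (congrArg Subtype.val h))
  -- The permutations with a given restriction to `A` lie in one coset of the pointwise stabiliser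
  -- of `A`, which has `(n - |A|)!` elements.
  refine (card_le_mul_card_image (f := f) s (n - A.card).factorial ?_).trans
    (Nat.mul_le_mul_left _ himg)
  intro g hg
  obtain ⟨σ₀, -, rfl⟩ := mem_image.1 hg
  have hc : Fintype.card {τ : Equiv.Perm (Fin n) // ∀ x, ¬ (x ∉ A) → τ x = x} =
      (n - A.card).factorial := by
    rw [← Fintype.card_congr (Equiv.Perm.subtypeEquivSubtypePerm fun x => x ∉ A),
      Fintype.card_perm]
    congr 1
    rw [Fintype.card_subtype_compl]
    simp
  rw [← hc, ← card_univ]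
  refine card_le_card_of_injOn (fun σ => if h : ∀ x, ¬ (x ∉ A) → (σ₀⁻¹ * σ) x = x
    then ⟨σ₀⁻¹ * σ, h⟩ else ⟨1, by simp⟩) (by simp) ?_
  have hfix : ∀ σ, f σ = f σ₀ → ∀ x, ¬ (x ∉ A) → (σ₀⁻¹ * σ) x = x := by
    intro σ h x hx
    have : σ x = σ₀ x := congrFun h ⟨x, not_not.1 hx⟩
    simp [Equiv.Perm.mul_apply, this]
  intro σ hσ τ hτ h
  have h1 := hfix σ (mem_filter.1 (mem_coe.1 hσ)).2
  have h2 := hfix τ (mem_filter.1 (mem_coe.1 hτ)).2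
  simp only [dif_pos h1, dif_pos h2, Subtype.mk.injEq] at h
  exact mul_left_cancel h

/-- A random permutation maps `A` into `C` with probability at most that of `|A|` independent
uniform choices. -/
lemma card_perm_mapsTo_le_real {n : ℕ} (hn : 0 < n) (A C : Finset (Fin n)) :
    ((univ.filter fun σ : Equiv.Perm (Fin n) => ∀ x ∈ A, σ x ∈ C).card : ℝ) ≤
      ((C.card : ℝ) / n) ^ A.card * n.factorial := by
  have hA : A.card ≤ n := by simpa using card_le_univ A
  have hC : C.card ≤ n := by simpa using card_le_univ C
  have h1 := card_perm_mapsTo_le A C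
  have h2 := descFactorial_mul_pow_le hC A.card
  have h3 := Nat.factorial_mul_descFactorial hA
  rw [div_pow, div_mul_eq_mul_div, le_div_iff₀ (by positivity)]
  have : (univ.filter fun σ : Equiv.Perm (Fin n) => ∀ x ∈ A, σ x ∈ C).card * n ^ A.card ≤
      C.card ^ A.card * n.factorial := by
    calc _ ≤ (n - A.card).factorial * C.card.descFactorial A.card * n ^ A.card :=
          Nat.mul_le_mul_right _ h1
      _ = (n - A.card).factorial * (C.card.descFactorial A.card * n ^ A.card) := by ring
      _ ≤ (n - A.card).factorial * (n.descFactorial A.card * C.card ^ A.card) :=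
          Nat.mul_le_mul_left _ h2
      _ = C.card ^ A.card * ((n - A.card).factorial * n.descFactorial A.card) := by ring
      _ = _ := by rw [h3]
  exact_mod_cast this

lemma choose_le_three_mul_div_pow {n k : ℕ} (hk : 0 < k) :
    (n.choose k : ℝ) ≤ (3 * n / k) ^ k := by
  have h1 : (n.choose k : ℝ) ≤ (n : ℝ) ^ k / k.factorial := Nat.choose_le_pow_div k n
  have h2 : (k : ℝ) ^ k / k.factorial ≤ 3 ^ k := by
    refine (Real.pow_div_factorial_le_exp (k : ℝ) (Nat.cast_nonneg k) k).trans ?_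
    rw [← Real.exp_one_pow]
    exact pow_le_pow_left₀ (Real.exp_pos 1).le (Real.exp_one_lt_d9.le.trans (by norm_num)) k
  have hk' : (0 : ℝ) < k := by exact_mod_cast hk
  have hf : (0 : ℝ) < k.factorial := by exact_mod_cast k.factorial_pos
  refine h1.trans ?_
  rw [div_pow, mul_pow, div_le_div_iff₀ hf (by positivity)]
  rw [div_le_iff₀ hf] at h2
  have : (0 : ℝ) ≤ (n : ℝ) ^ k := by positivity
  nlinarith

/-- With `x = c/n`, choosing the two sets costs at most `(54 / x³)ᵃ`, and 32 permutations contribute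
`x^(32a)`. The two bounds on `c` together give `x ≤ 2/3`, so `54 x²⁹` is small. -/
lemma union_bound_term {n a : ℕ} (ha : 0 < a) (han : 2 * a ≤ n) :
    (n.choose a : ℝ) * n.choose (min (2 * a - 1) (n - a)) *
      (((min (2 * a - 1) (n - a) : ℕ) : ℝ) / n) ^ (a * 32) ≤ (1 / 4) ^ a := by
  set c := min (2 * a - 1) (n - a) with hc
  have hc0 : 0 < c := by omega
  have hc2 : c ≤ 2 * a := by omega
  have hc3 : 3 * c ≤ 2 * n := by omega
  have hcn : c ≤ n := by omega
  have hn : (0 : ℝ) < n := by exact_mod_cast (by omega : 0 < n)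
  have hcR : (0 : ℝ) < c := by exact_mod_cast hc0
  have haR : (0 : ℝ) < a := by exact_mod_cast ha
  set x : ℝ := c / n with hx
  have hx0 : 0 < x := by positivity
  have hx23 : x ≤ 2 / 3 := by
    rw [hx, div_le_div_iff₀ hn (by norm_num)]
    have : (3 : ℝ) * c ≤ 2 * n := by exact_mod_cast hc3
    linarith
  have h1 : (n.choose a : ℝ) ≤ (6 / x) ^ a := by
    refine (choose_le_three_mul_div_pow ha).trans (pow_le_pow_left₀ (by positivity) ?_ a)
    rw [hx, div_div_eq_mul_div, div_le_div_iff₀ haR hcR]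
    have : (c : ℝ) ≤ 2 * a := by exact_mod_cast hc2
    nlinarith
  have h2 : (n.choose c : ℝ) ≤ ((3 / x) ^ 2) ^ a := by
    refine (choose_le_three_mul_div_pow hc0).trans ?_
    have : (3 * n / c : ℝ) = 3 / x := by rw [hx]; field_simp
    rw [this, ← pow_mul]
    refine pow_le_pow_right₀ ?_ hc2
    rw [le_div_iff₀ hx0]; linarith
  calc (n.choose a : ℝ) * n.choose c * x ^ (a * 32)
      ≤ (6 / x) ^ a * ((3 / x) ^ 2) ^ a * x ^ (a * 32) := by gcongr
    _ = (54 * x ^ 29) ^ a := by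
        rw [mul_comm a 32, pow_mul, ← mul_pow, ← mul_pow]
        congr 1
        field_simp; norm_num
    _ ≤ (1 / 4) ^ a := by
        refine pow_le_pow_left₀ (by positivity) ?_ a
        calc 54 * x ^ 29 ≤ 54 * (2 / 3) ^ 29 := by gcongr
          _ ≤ 1 / 4 := by norm_num

/-- The joint image of `A` under a family of permutations. -/
def permImage {n : ℕ} (π : Fin 32 → Equiv.Perm (Fin n)) (A : Finset (Fin n)) : Finset (Fin n) :=
  A.biUnion fun x => univ.image fun j => π j x

lemma mem_permImage {n : ℕ} {π : Fin 32 → Equiv.Perm (Fin n)} {A : Finset (Fin n)} {z : Fin n} :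
    z ∈ permImage π A ↔ ∃ x ∈ A, ∃ j, π j x = z := by
  simp [permImage]

lemma card_le_card_permImage {n : ℕ} (π : Fin 32 → Equiv.Perm (Fin n)) (A : Finset (Fin n)) :
    A.card ≤ (permImage π A).card :=
  card_le_card_of_injOn (π 0) (fun x hx => mem_permImage.2 ⟨x, hx, 0, rfl⟩)
    (π 0).injective.injOn

/-- Families of permutations that fail to expand. -/
def Contracting {n : ℕ} (π : Fin 32 → Equiv.Perm (Fin n)) : Prop :=
  ∃ A : Finset (Fin n), A.Nonempty ∧ (permImage π A).card < 2 * A.card ∧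
    (permImage π A).card + A.card ≤ n

-- A union bound over the contracted set `A` and a set containing its joint image. The terms are at
-- most `4⁻ᵃ` and sum to less than 1/3. A probability below 1/2 is needed because the inverses must
-- expand too.
open Classical in
lemma card_contracting_lt {n : ℕ} (hn : 0 < n) :
    ((univ.filter fun π : Fin 32 → Equiv.Perm (Fin n) => Contracting π).card : ℝ) <
      1 / 2 * (n.factorial : ℝ) ^ 32 := by
  have hsub : (univ.filter fun π : Fin 32 → Equiv.Perm (Fin n) => Contracting π) ⊆
      (Icc 1 (n / 2)).biUnion fun a => (powersetCard a univ ×ˢ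
        powersetCard (min (2 * a - 1) (n - a)) univ).biUnion fun AC =>
          Fintype.piFinset fun _ : Fin 32 =>
            univ.filter fun σ : Equiv.Perm (Fin n) => ∀ x ∈ AC.1, σ x ∈ AC.2 := by
    intro π hπ
    obtain ⟨A, hA, h1, h2⟩ := (mem_filter.1 hπ).2
    have h3 := card_le_card_permImage π A
    have h4 := card_pos.2 hA
    -- Padding the image to the largest size that contraction allows leaves a single size of `C` to
    -- consider for each size of `A`.
    obtain ⟨C, hC, hCc⟩ := exists_superset_card_eq (s := permImage π A)
      (n := min (2 * A.card - 1) (n - A.card)) (by omega) (by rw [Fintype.card_fin]; omega)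
    refine mem_biUnion.2 ⟨A.card, mem_Icc.2 ⟨h4, by omega⟩, mem_biUnion.2 ⟨(A, C),
      mem_product.2 ⟨mem_powersetCard.2 ⟨subset_univ _, rfl⟩,
        mem_powersetCard.2 ⟨subset_univ _, hCc⟩⟩, ?_⟩⟩
    refine Fintype.mem_piFinset.2 fun j => mem_filter.2 ⟨mem_univ _, fun x hx => hC ?_⟩
    exact mem_permImage.2 ⟨x, hx, j, rfl⟩
  have hF : (0 : ℝ) < n.factorial := by exact_mod_cast n.factorial_pos
  have hterm : ∀ a ∈ Icc 1 (n / 2), (((powersetCard a univ ×ˢ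
        powersetCard (min (2 * a - 1) (n - a)) univ).biUnion fun AC =>
          Fintype.piFinset fun _ : Fin 32 =>
            univ.filter fun σ : Equiv.Perm (Fin n) => ∀ x ∈ AC.1, σ x ∈ AC.2).card : ℝ) ≤
      (1 / 4) ^ a * (n.factorial : ℝ) ^ 32 := by
    intro a ha
    rw [mem_Icc] at ha
    set c := min (2 * a - 1) (n - a) with hc
    have h1 : ∀ AC ∈ (powersetCard a univ ×ˢ powersetCard c univ :
        Finset (Finset (Fin n) × Finset (Fin n))), ((Fintype.piFinset fun _ : Fin 32 =>
          univ.filter fun σ : Equiv.Perm (Fin n) => ∀ x ∈ AC.1, σ x ∈ AC.2).card : ℝ) ≤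
          (((c : ℝ) / n) ^ a * n.factorial) ^ 32 := by
      intro AC hAC
      obtain ⟨hA, hC⟩ := mem_product.1 hAC
      have hA := (mem_powersetCard.1 hA).2
      have hC := (mem_powersetCard.1 hC).2
      rw [Fintype.card_piFinset, Finset.prod_const, card_univ, Fintype.card_fin, Nat.cast_pow]
      refine pow_le_pow_left₀ (Nat.cast_nonneg _) ?_ _
      have := card_perm_mapsTo_le_real hn AC.1 AC.2
      rwa [hA, hC] at this
    calc _ ≤ ∑ AC ∈ (powersetCard a univ ×ˢ powersetCard c univ :
          Finset (Finset (Fin n) × Finset (Fin n))), ((Fintype.piFinset fun _ : Fin 32 =>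
          univ.filter fun σ : Equiv.Perm (Fin n) => ∀ x ∈ AC.1, σ x ∈ AC.2).card : ℝ) := by
          exact_mod_cast card_biUnion_le
      _ ≤ _ := Finset.sum_le_card_nsmul _ _ _ h1
      _ = ((n.choose a : ℝ) * n.choose c * ((c : ℝ) / n) ^ (a * 32)) * (n.factorial : ℝ) ^ 32 := by
          rw [card_product, card_powersetCard, card_powersetCard, card_univ, Fintype.card_fin,
            nsmul_eq_mul, mul_pow, ← pow_mul]
          push_cast
          ring
      _ ≤ _ := by
          refine mul_le_mul_of_nonneg_right (union_bound_term (by omega) (by omega)) (by positivity)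
  have hgeom : ∀ m : ℕ, ∑ a ∈ Icc 1 m, (1 / 4 : ℝ) ^ a ≤ 1 / 3 * (1 - (1 / 4) ^ m) := by
    intro m
    induction m with
    | zero => simp
    | succ m ih =>
      rw [Finset.sum_Icc_succ_top (by omega), pow_succ]
      linarith
  calc _ ≤ (((Icc 1 (n / 2)).biUnion fun a => (powersetCard a univ ×ˢ
        powersetCard (min (2 * a - 1) (n - a)) univ).biUnion fun AC =>
          Fintype.piFinset fun _ : Fin 32 =>
            univ.filter fun σ : Equiv.Perm (Fin n) => ∀ x ∈ AC.1, σ x ∈ AC.2).card : ℝ) := by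
        exact_mod_cast card_le_card hsub
    _ ≤ ∑ a ∈ Icc 1 (n / 2), (((powersetCard a univ ×ˢ
        powersetCard (min (2 * a - 1) (n - a)) univ).biUnion fun AC =>
          Fintype.piFinset fun _ : Fin 32 =>
            univ.filter fun σ : Equiv.Perm (Fin n) => ∀ x ∈ AC.1, σ x ∈ AC.2).card : ℝ) := by
        exact_mod_cast card_biUnion_le
    _ ≤ ∑ a ∈ Icc 1 (n / 2), (1 / 4 : ℝ) ^ a * (n.factorial : ℝ) ^ 32 :=
        Finset.sum_le_sum hterm
    _ = (∑ a ∈ Icc 1 (n / 2), (1 / 4 : ℝ) ^ a) * (n.factorial : ℝ) ^ 32 := by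
        rw [Finset.sum_mul]
    _ < _ := by
        refine mul_lt_mul_of_pos_right ((hgeom _).trans_lt ?_) (by positivity)
        have : (0 : ℝ) < (1 / 4) ^ (n / 2) := by positivity
        linarith

/-- There is a family of permutations such that both the family and its inverses expand. -/
lemma exists_expanding_perms {n : ℕ} (hn : 0 < n) :
    ∃ π : Fin 32 → Equiv.Perm (Fin n), ¬ Contracting π ∧ ¬ Contracting fun j => (π j)⁻¹ := by
  classical
  by_contra hcon
  push Not at hcon
  have hinv : (univ.filter fun π : Fin 32 → Equiv.Perm (Fin n) =>
      Contracting fun j => (π j)⁻¹).card =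
      (univ.filter fun π : Fin 32 → Equiv.Perm (Fin n) => Contracting π).card := by
    refine card_bij (fun π _ j => (π j)⁻¹) (fun π hπ => mem_filter.2 ⟨mem_univ _,
      (mem_filter.1 hπ).2⟩) (fun π _ π' _ h => ?_) fun π hπ => ?_
    · funext j
      exact inv_injective (congrFun h j)
    · exact ⟨fun j => (π j)⁻¹, mem_filter.2 ⟨mem_univ _, by simpa using (mem_filter.1 hπ).2⟩,
        by simp⟩
  have hcov : (univ : Finset (Fin 32 → Equiv.Perm (Fin n))) ⊆
      (univ.filter fun π => Contracting π) ∪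
        (univ.filter fun π => Contracting fun j => (π j)⁻¹) := by
    intro π _
    by_cases h : Contracting π
    · exact mem_union_left _ (mem_filter.2 ⟨mem_univ _, h⟩)
    · exact mem_union_right _ (mem_filter.2 ⟨mem_univ _, hcon π h⟩)
  have h1 := (card_le_card hcov).trans (card_union_le _ _)
  rw [hinv, card_univ, Fintype.card_fun, Fintype.card_perm, Fintype.card_fin, Fintype.card_fin]
    at h1
  have h2 := card_contracting_lt hn
  have h3 : (n.factorial : ℝ) ^ 32 ≤
      ((univ.filter fun π : Fin 32 → Equiv.Perm (Fin n) => Contracting π).card : ℝ) +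
      (univ.filter fun π : Fin 32 → Equiv.Perm (Fin n) => Contracting π).card := by
    exact_mod_cast h1
  linarith

end Expander

/-! ### Resilient bipartite templates of bounded degree. -/

section Template

/-- Two copies of `Fin n` as left vertices, joined through expanding permutations to two copies
of `Fin n` with `D₀` vertices removed from one of them: after the removal of any `D₀` vertices
from the first copy on the right there is a perfect matching. -/
lemma exists_matching_of_expanding {n D₀ : ℕ} (hD₀ : D₀ ≤ n)
    {π : Fin 32 → Equiv.Perm (Fin n)} (hπ : ¬ Contracting π)
    (hπ' : ¬ Contracting fun j => (π j)⁻¹) (D : Finset (Fin n)) (hD : D.card = D₀) :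
    ∃ f : Fin n ⊕ Fin (n - D₀) → Bool × Fin n, Function.Injective f ∧
      (∀ s, ∃ j, (f s).2 = π j (Sum.elim id (Fin.castLE (Nat.sub_le n D₀)) s)) ∧
      ∀ s, ∀ d ∈ D, f s ≠ (false, d) := by
  classical
  set idx : Fin n ⊕ Fin (n - D₀) → Fin n := Sum.elim id (Fin.castLE (Nat.sub_le n D₀)) with hidx
  set t : Fin n ⊕ Fin (n - D₀) → Finset (Bool × Fin n) := fun s =>
    (univ.filter fun z => (∃ j, z.2 = π j (idx s)) ∧ ∀ d ∈ D, z ≠ (false, d)) with ht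
  obtain ⟨f, hf, hft⟩ := (Finset.all_card_le_biUnion_card_iff_exists_injective t).1 (by
    intro S
    set A := S.image idx with hA
    set N := permImage π A with hN
    have hsub : (N.image fun z => (true, z)) ∪ ((N \ D).image fun z => (false, z)) ⊆
        S.biUnion t := by
      intro z hz
      rcases mem_union.1 hz with hz | hz
      · obtain ⟨w, hw, rfl⟩ := mem_image.1 hz
        obtain ⟨x, hx, j, rfl⟩ := mem_permImage.1 hw
        obtain ⟨s, hs, rfl⟩ := mem_image.1 hx
        exact mem_biUnion.2 ⟨s, hs, mem_filter.2 ⟨mem_univ _, ⟨j, rfl⟩, by simp⟩⟩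
      · obtain ⟨w, hw, rfl⟩ := mem_image.1 hz
        obtain ⟨hw, hwD⟩ := mem_sdiff.1 hw
        obtain ⟨x, hx, j, rfl⟩ := mem_permImage.1 hw
        obtain ⟨s, hs, rfl⟩ := mem_image.1 hx
        refine mem_biUnion.2 ⟨s, hs, mem_filter.2 ⟨mem_univ _, ⟨j, rfl⟩, fun d hd h => ?_⟩⟩
        rw [Prod.mk.injEq] at h
        exact hwD (h.2 ▸ hd)
    have hcard : N.card + (N \ D).card ≤ (S.biUnion t).card := by
      refine le_trans (le_of_eq ?_) (card_le_card hsub)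
      rw [card_union_of_disjoint, card_image_of_injective, card_image_of_injective]
      · exact fun x y h => (Prod.mk.inj h).2
      · exact fun x y h => (Prod.mk.inj h).2
      · rw [disjoint_left]
        rintro z hz hz'
        obtain ⟨w, _, rfl⟩ := mem_image.1 hz
        obtain ⟨w', _, h⟩ := mem_image.1 hz'
        simp at h
    have hND : N.card ≤ (N \ D).card + D₀ := by
      rw [← hD]; exact card_le_card_sdiff_add_card
    have hdj : S.card = S.toLeft.card + S.toRight.card := (card_toLeft_add_card_toRight).symm
    have hl : S.toLeft.card ≤ A.card :=
      card_le_card_of_injOn id (fun x hx => mem_image.2 ⟨Sum.inl x, mem_toLeft.1 hx, rfl⟩)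
        Function.injective_id.injOn
    have hr : S.toRight.card ≤ A.card :=
      card_le_card_of_injOn (Fin.castLE (Nat.sub_le n D₀))
        (fun x hx => mem_image.2 ⟨Sum.inr x, mem_toRight.1 hx, rfl⟩)
        (Fin.castLE_injective _).injOn
    have hr' : S.toRight.card ≤ n - D₀ := by simpa using card_le_univ S.toRight
    have hAN : A.card ≤ N.card := card_le_card_permImage π A
    have hNn : N.card ≤ n := by simpa using card_le_univ N
    rcases S.eq_empty_or_nonempty with rfl | hne
    · simp
    have hAne : A.Nonempty := hne.image _
    -- If `A` doubles, the undamaged copy on the right already has `2|A| ≥ |S|` neighbours.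
    by_cases h2 : 2 * A.card ≤ N.card
    · omega
    have h3 : n < N.card + A.card := by
      by_contra h
      exact hπ ⟨A, hAne, by rw [← hN]; omega, by rw [← hN]; omega⟩
    have hNc : (Nᶜ).card = n - N.card := by rw [card_compl, Fintype.card_fin]
    rcases (Nᶜ).eq_empty_or_nonempty with h0 | hBne
    · rw [h0, card_empty] at hNc
      omega
    -- Otherwise `Nᶜ` is small and doubles under the inverses, away from `A`. Thus `|A| ≤ n - 2(n -
    -- |N|)`, so `2|N| - D₀ ≥ |A| + n - D₀ ≥ |S|`.
    have hMA : Disjoint (permImage (fun j => (π j)⁻¹) Nᶜ) A := by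
      rw [disjoint_left]
      intro x hx hxA
      obtain ⟨y, hy, j, rfl⟩ := mem_permImage.1 hx
      refine (mem_compl.1 hy) (mem_permImage.2 ⟨_, hxA, j, ?_⟩)
      simp
    have hMA' : (permImage (fun j => (π j)⁻¹) Nᶜ).card + A.card ≤ n := by
      rw [← card_union_of_disjoint hMA]
      simpa using card_le_univ (permImage (fun j => (π j)⁻¹) Nᶜ ∪ A)
    have h4 : 2 * (Nᶜ).card ≤ (permImage (fun j => (π j)⁻¹) Nᶜ).card := by
      by_contra h
      exact hπ' ⟨Nᶜ, hBne, by omega, by omega⟩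
    omega)
  exact ⟨f, hf, fun s => (mem_filter.1 (hft s)).2.1, fun s => (mem_filter.1 (hft s)).2.2⟩

/-- The chain gadget: a slot with a list of `e + 1` options is replaced by `e + 1` slots with lists
of size at most three, at the cost of `e` additional fillers. -/
def chainRel {S₀ Z₀ : Type*} {e : ℕ} (o : S₀ → Fin (e + 1) → Z₀) (s : S₀ × Fin (e + 1)) :
    Z₀ ⊕ S₀ × Fin e → Prop
  | Sum.inl z => o s.1 s.2 = z
  | Sum.inr w => w.1 = s.1 ∧ (w.2.castSucc = s.2 ∨ w.2.succ = s.2)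

/-- The chosen option of a slot goes to its position in the chain. Positions before it take the
chain filler on their right, positions after it the one on their left, so all `e` chain fillers are
used exactly once. -/
lemma exists_chain_matching {S₀ Z₀ : Type*} {e : ℕ} (o : S₀ → Fin (e + 1) → Z₀)
    (ch : S₀ → Fin (e + 1)) (hch : Function.Injective fun s => o s (ch s)) :
    ∃ g : S₀ × Fin (e + 1) → Z₀ ⊕ S₀ × Fin e, Function.Injective g ∧
      (∀ s, chainRel o s (g s)) ∧ ∀ s z, g s = Sum.inl z → ∃ s₀, z = o s₀ (ch s₀) := by
  classical
  set g : S₀ × Fin (e + 1) → Z₀ ⊕ S₀ × Fin e := fun s =>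
    if h : s.2.val < (ch s.1).val then
      Sum.inr (s.1, ⟨s.2.val, by have := (ch s.1).isLt; omega⟩)
    else if h' : s.2 = ch s.1 then Sum.inl (o s.1 (ch s.1))
    else Sum.inr (s.1, ⟨s.2.val - 1, by
      have := s.2.isLt
      have : s.2.val ≠ (ch s.1).val := fun h => h' (Fin.ext h)
      omega⟩) with hg
  refine ⟨g, ?_, ?_, ?_⟩
  · rintro ⟨s, i⟩ ⟨s', i'⟩ h
    simp only [hg] at h
    split_ifs at h with h1 h2 h3 h4 h5 h6 h7 h8
    · simp only [Sum.inr.injEq, Prod.mk.injEq, Fin.mk.injEq] at h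
      exact Prod.ext h.1 (Fin.ext h.2)
    · simp only [Sum.inr.injEq, Prod.mk.injEq, Fin.mk.injEq] at h
      obtain ⟨rfl, h⟩ := h
      have : i'.val ≠ (ch s).val := fun h => h3 (Fin.ext h)
      omega
    · simp only [Sum.inl.injEq] at h
      have := hch h
      subst this
      rw [h4, h6]
    · simp only [Sum.inr.injEq, Prod.mk.injEq, Fin.mk.injEq] at h
      obtain ⟨rfl, h⟩ := h
      have : i.val ≠ (ch s).val := fun h => h4 (Fin.ext h)
      omega
    · simp only [Sum.inr.injEq, Prod.mk.injEq, Fin.mk.injEq] at h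
      obtain ⟨rfl, h⟩ := h
      have : i.val ≠ (ch s).val := fun h => h4 (Fin.ext h)
      have : i'.val ≠ (ch s).val := fun h => h8 (Fin.ext h)
      exact Prod.ext rfl (Fin.ext (by dsimp only; omega))
  · rintro ⟨s, i⟩
    simp only [hg]
    split_ifs with h1 h2
    · exact ⟨rfl, Or.inl (Fin.ext rfl)⟩
    · simp only [chainRel]
      rw [h2]
    · refine ⟨rfl, Or.inr (Fin.ext ?_)⟩
      have : i.val ≠ (ch s).val := fun h => h2 (Fin.ext h)
      simp only [Fin.val_succ]
      omega
  · rintro ⟨s, i⟩ z h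
    simp only [hg] at h
    split_ifs at h with h1 h2
    · exact ⟨s, (Sum.inl.inj h).symm⟩

/-- A resilient template of bounded degree: there are slots `S` and fillers `Z`, the latter
including `n` flexible ones, such that after the removal of any `D₀` of the flexible fillers the
slots can be matched to the remaining fillers. -/
theorem exists_template {n D₀ : ℕ} (hn : 0 < n) (hD₀ : D₀ ≤ n) :
    ∃ (Z S : Type) (_ : Fintype Z) (_ : Fintype S) (Γ : S → Z → Prop) (y : Fin n → Z),
      Function.Injective y ∧ Fintype.card S + D₀ = Fintype.card Z ∧ Fintype.card Z ≤ 128 * n ∧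
      (∀ s, ∃ L : Finset Z, L.card ≤ 3 ∧ ∀ z, Γ s z → z ∈ L) ∧
      (∀ z, ∃ L : Finset S, L.card ≤ 64 ∧ ∀ s, Γ s z → s ∈ L) ∧
      ∀ D : Finset (Fin n), D.card = D₀ → ∃ g : S → Z, Function.Injective g ∧ (∀ s, Γ s (g s)) ∧
        ∀ s, ∀ d ∈ D, g s ≠ y d := by
  classical
  obtain ⟨π, hπ, hπ'⟩ := exists_expanding_perms hn
  set idx : Fin n ⊕ Fin (n - D₀) → Fin n := Sum.elim id (Fin.castLE (Nat.sub_le n D₀)) with hidx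
  have ε : Fin (63 + 1) ≃ Bool × Fin 32 := Fintype.equivOfCardEq (by simp)
  -- A slot has 64 options: 32 permutations and two copies on the right. Chains cut this to three,
  -- so that a vertex next to a slot will gain degree two only. There are `64(2n - D₀)` slots and
  -- `2n + 63(2n - D₀)` fillers, a difference of `D₀`.
  set o : Fin n ⊕ Fin (n - D₀) → Fin (63 + 1) → Bool × Fin n := fun s i =>
    ((ε i).1, π (ε i).2 (idx s)) with ho
  refine ⟨(Bool × Fin n) ⊕ ((Fin n ⊕ Fin (n - D₀)) × Fin 63),
    (Fin n ⊕ Fin (n - D₀)) × Fin (63 + 1), inferInstance, inferInstance, chainRel o,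
    fun x => Sum.inl (false, x), fun x y h => (Prod.mk.inj (Sum.inl.inj h)).2, ?_, ?_, ?_, ?_, ?_⟩
  · simp only [Fintype.card_prod, Fintype.card_sum, Fintype.card_fin, Fintype.card_bool]
    omega
  · simp only [Fintype.card_prod, Fintype.card_sum, Fintype.card_fin, Fintype.card_bool]
    omega
  · rintro ⟨s, i⟩
    refine ⟨{Sum.inl (o s i)} ∪ ((univ.filter fun w : Fin 63 => w.castSucc = i).image
      (fun w => Sum.inr (s, w)) ∪ (univ.filter fun w : Fin 63 => w.succ = i).image
      (fun w => Sum.inr (s, w))), ?_, ?_⟩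
    · have h1 : (univ.filter fun w : Fin 63 => w.castSucc = i).card ≤ 1 :=
        card_le_one.2 fun a ha b hb => Fin.castSucc_injective _
          ((mem_filter.1 ha).2.trans (mem_filter.1 hb).2.symm)
      have h2 : (univ.filter fun w : Fin 63 => w.succ = i).card ≤ 1 :=
        card_le_one.2 fun a ha b hb => Fin.succ_injective _
          ((mem_filter.1 ha).2.trans (mem_filter.1 hb).2.symm)
      refine (card_union_le _ _).trans ?_
      refine (Nat.add_le_add_left (card_union_le _ _) _).trans ?_
      have h3 := card_image_le (s := univ.filter fun w : Fin 63 => w.castSucc = i)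
        (f := fun w => (Sum.inr (s, w) : (Bool × Fin n) ⊕ ((Fin n ⊕ Fin (n - D₀)) × Fin 63)))
      have h4 := card_image_le (s := univ.filter fun w : Fin 63 => w.succ = i)
        (f := fun w => (Sum.inr (s, w) : (Bool × Fin n) ⊕ ((Fin n ⊕ Fin (n - D₀)) × Fin 63)))
      rw [card_singleton]
      omega
    · rintro (z | ⟨s', w⟩) h
      · simp only [chainRel] at h
        rw [← h]
        exact mem_union_left _ (mem_singleton_self _)
      · simp only [chainRel] at h
        obtain ⟨rfl, h⟩ := h
        refine mem_union_right _ ?_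
        rcases h with h | h
        · exact mem_union_left _ (mem_image.2 ⟨w, mem_filter.2 ⟨mem_univ _, h⟩, rfl⟩)
        · exact mem_union_right _ (mem_image.2 ⟨w, mem_filter.2 ⟨mem_univ _, h⟩, rfl⟩)
  · rintro (z | ⟨s, w⟩)
    · refine ⟨univ.filter fun s => chainRel o s (Sum.inl z), ?_,
        fun s hs => mem_filter.2 ⟨mem_univ _, hs⟩⟩
      have : (univ : Finset (Bool × Fin 32)).card = 64 := by simp
      rw [← this]
      refine card_le_card_of_injOn (fun s => (s.1.isLeft, (ε s.2).2)) (by simp) ?_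
      rintro ⟨s, i⟩ hs ⟨s', i'⟩ hs' h
      have h1 : o s i = z := (mem_filter.1 (mem_coe.1 hs)).2
      have h2 : o s' i' = z := (mem_filter.1 (mem_coe.1 hs')).2
      have h3 := Prod.mk.inj h
      have h4 := Prod.mk.inj (h1.trans h2.symm)
      simp only at h3
      have hii : i = i' := ε.injective (Prod.ext h4.1 h3.2)
      subst hii
      have hss : idx s = idx s' := (π (ε i).2).injective h4.2
      have : s = s' := by
        rcases s with s | s <;> rcases s' with s' | s'
        · simpa [hidx] using hss
        · simp at h3
        · simp at h3
        · exact congrArg Sum.inr (Fin.castLE_injective (Nat.sub_le n D₀) hss)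
      rw [this]
    · refine ⟨{(s, w.castSucc), (s, w.succ)}, card_le_two.trans (by norm_num), ?_⟩
      rintro ⟨s', i⟩ h
      simp only [chainRel] at h
      obtain ⟨rfl, rfl | rfl⟩ := h <;> simp
  · intro D hD
    obtain ⟨f, hf, hfπ, hfD⟩ := exists_matching_of_expanding hD₀ hπ hπ' D hD
    choose j hj using hfπ
    set ch : Fin n ⊕ Fin (n - D₀) → Fin (63 + 1) := fun s => ε.symm ((f s).1, j s) with hch
    have hof : ∀ s, o s (ch s) = f s := fun s => by
      simp only [ho, hch, Equiv.apply_symm_apply]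
      exact Prod.ext rfl (hj s).symm
    obtain ⟨g, hg, hgr, hgo⟩ := exists_chain_matching o ch (by
      intro s s' h
      simp only [hof] at h
      exact hf h)
    refine ⟨g, hg, hgr, fun s d hd h => ?_⟩
    obtain ⟨s₀, hs₀⟩ := hgo s _ h
    exact hfD s₀ d hd (by rw [← hof s₀, ← hs₀])

end Template

/-! ### The absorber: template graph, cover and completion. -/

section Absorber

variable {V β : Type*}

/-- A tiling is obtained from an injective family of copies leaving fewer than `|H|` vertices. -/
lemma hasTiling_of_family [Fintype β] {ι : Type*} [Fintype ι] (H : SimpleGraph β)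
    (K : SimpleGraph V) (s : Finset V) (Φ : ι × β → V) (hΦ : Function.Injective Φ)
    (hs : ∀ p, Φ p ∈ s) (hadj : ∀ c x y, H.Adj x y → K.Adj (Φ (c, x)) (Φ (c, y))) {r : ℕ}
    (hcard : s.card = Fintype.card ι * Fintype.card β + r) (hr : r < Fintype.card β) :
    HasTiling H (K.induce (s : Set V)) := by
  classical
  set e := (Fintype.equivFin ι).symm with he
  set Ψ : Fin (Fintype.card ι) × β → (s : Set V) := fun p => ⟨Φ (e p.1, p.2), hs _⟩ with hΨ
  have hΨi : Function.Injective Ψ := by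
    rintro ⟨i, x⟩ ⟨j, y⟩ h
    have h1 := Prod.mk.inj (hΦ (congrArg Subtype.val h))
    exact Prod.ext (e.injective h1.1) h1.2
  refine ⟨Fintype.card ι, fun i => ⟨⟨fun x => Ψ (i, x), fun {x y} h => hadj _ _ _ h⟩,
    fun x y h => (Prod.mk.inj (hΨi h)).2⟩, fun i j hij => ?_, ?_⟩
  · rw [Set.disjoint_left]
    rintro _ ⟨x, rfl⟩ ⟨y, h⟩
    exact hij (Prod.mk.inj (hΨi h)).1.symm
  · have hU : (⋃ i, Set.range (fun x => Ψ (i, x))) = Set.range Ψ := by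
      ext v
      simp only [Set.mem_iUnion, Set.mem_range, Prod.exists]
    have hcU : (Set.range Ψ).ncard = Fintype.card ι * Fintype.card β := by
      rw [← Set.image_univ, Set.ncard_image_of_injective _ hΨi, Set.ncard_univ]
      simp
    have hs' : Nat.card (s : Set V) = s.card := by simp
    change (⋃ i, Set.range (fun x => Ψ (i, x)))ᶜ.ncard ≤ _
    rw [hU, hs', hcard, Nat.card_eq_fintype_card, Nat.mul_add_mod_self_right, Nat.mod_eq_of_lt hr]
    have := Set.ncard_add_ncard_compl (Set.range Ψ)
    rw [hs', hcU, hcard] at this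
    omega

/-- Disjoint copies of `H` indexed by `J`. -/
def copies (J : Type*) (H : SimpleGraph β) : SimpleGraph (J × β) where
  Adj p q := p.1 = q.1 ∧ H.Adj p.2 q.2
  symm := ⟨fun _ _ h => ⟨h.1.symm, h.2.symm⟩⟩
  loopless := ⟨fun _ h => H.loopless.irrefl _ h.2⟩

/-- Disjoint copies of `H` in which some vertices `σ s` have been replaced by the fillers `z` with
`Γ s z`. -/
def templateGraph {Z S J : Type*} (H : SimpleGraph β) (Γ : S → Z → Prop) (σ : S → J × β) :
    SimpleGraph (Z ⊕ J × β) where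
  Adj
    | Sum.inl _, Sum.inl _ => False
    | Sum.inl z, Sum.inr p => ∃ s, (σ s).1 = p.1 ∧ H.Adj p.2 (σ s).2 ∧ Γ s z
    | Sum.inr p, Sum.inl z => ∃ s, (σ s).1 = p.1 ∧ H.Adj p.2 (σ s).2 ∧ Γ s z
    | Sum.inr p, Sum.inr q => p.1 = q.1 ∧ H.Adj p.2 q.2 ∧ (∀ s, σ s ≠ p) ∧ ∀ s, σ s ≠ q
  symm := ⟨by
    rintro (z | p) (z' | q) h
    · exact h
    · exact h
    · exact h
    · exact ⟨h.1.symm, h.2.1.symm, h.2.2.2, h.2.2.1⟩⟩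
  loopless := ⟨by
    rintro (z | p) h
    · exact h
    · exact H.loopless.irrefl _ h.2.1⟩

/-- As no two vertices of `I` have a common neighbour, each vertex is adjacent to at most one slot.
That single neighbour is replaced by at most three fillers. -/
lemma card_nbIn_templateGraph_inr {Z S J : Type*} [Fintype Z] [Fintype J] [Fintype β]
    (H : SimpleGraph β) {Δ : ℕ} (hH : ∀ x, (nbIn H univ x).card ≤ Δ) {I : Finset β}
    (hI : ∀ z, ∀ x ∈ I, ∀ y ∈ I, H.Adj z x → H.Adj z y → x = y) (Γ : S → Z → Prop) (σ : S → J × β)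
    (hσ : Function.Injective σ) (hσI : ∀ s, (σ s).2 ∈ I)
    (hΓ : ∀ s, ∃ L : Finset Z, L.card ≤ 3 ∧ ∀ z, Γ s z → z ∈ L) (p : J × β) :
    (nbIn (templateGraph H Γ σ) univ (Sum.inr p)).card ≤ Δ + 2 := by
  classical
  by_cases hs : ∃ s, (σ s).1 = p.1 ∧ H.Adj p.2 (σ s).2
  · obtain ⟨s, hs1, hs2⟩ := hs
    obtain ⟨L, hL, hLΓ⟩ := hΓ s
    have hsub : nbIn (templateGraph H Γ σ) univ (Sum.inr p) ⊆
        L.image Sum.inl ∪ ((nbIn H univ p.2).erase (σ s).2).image fun x => Sum.inr (p.1, x) := by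
      rintro (z | q) hq
      · obtain ⟨s', h1, h2, h3⟩ := (mem_nbIn.1 hq).2
        have : s' = s := hσ (Prod.ext (h1.trans hs1.symm)
          (hI p.2 _ (hσI s') _ (hσI s) h2 hs2))
        subst this
        exact mem_union_left _ (mem_image.2 ⟨z, hLΓ z h3, rfl⟩)
      · obtain ⟨h1, h2, -, h4⟩ := (mem_nbIn.1 hq).2
        refine mem_union_right _ (mem_image.2 ⟨q.2, mem_erase.2 ⟨fun h => ?_,
          mem_nbIn.2 ⟨mem_univ _, h2⟩⟩, by rw [h1]⟩)
        exact h4 s (Prod.ext (hs1.trans h1) h.symm)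
    have h1 := (card_le_card hsub).trans (card_union_le _ _)
    have h2 := card_image_le (s := L) (f := (Sum.inl : Z → Z ⊕ J × β))
    have h3 := card_image_le (s := (nbIn H univ p.2).erase (σ s).2)
      (f := fun x => (Sum.inr (p.1, x) : Z ⊕ J × β))
    have h5 : (σ s).2 ∈ nbIn H univ p.2 := mem_nbIn.2 ⟨mem_univ _, hs2⟩
    rw [card_erase_of_mem h5] at h3
    have h4 := hH p.2
    have h6 := card_pos.2 ⟨_, h5⟩
    omega
  · have hsub : nbIn (templateGraph H Γ σ) univ (Sum.inr p) ⊆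
        (nbIn H univ p.2).image fun x => Sum.inr (p.1, x) := by
      rintro (z | q) hq
      · obtain ⟨s', h1, h2, h3⟩ := (mem_nbIn.1 hq).2
        exact absurd ⟨s', h1, h2⟩ hs
      · obtain ⟨h1, h2, -, -⟩ := (mem_nbIn.1 hq).2
        exact mem_image.2 ⟨q.2, mem_nbIn.2 ⟨mem_univ _, h2⟩, by rw [h1]⟩
    have := ((card_le_card hsub).trans card_image_le).trans (hH p.2)
    omega

lemma card_nbIn_templateGraph_inl {Z S J : Type*} [Fintype Z] [Fintype J] [Fintype β]
    (H : SimpleGraph β) {Δ d : ℕ} (hH : ∀ x, (nbIn H univ x).card ≤ Δ) (Γ : S → Z → Prop)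
    (σ : S → J × β) (hΓ : ∀ z, ∃ L : Finset S, L.card ≤ d ∧ ∀ s, Γ s z → s ∈ L) (z : Z) :
    (nbIn (templateGraph H Γ σ) univ (Sum.inl z)).card ≤ d * Δ := by
  classical
  obtain ⟨L, hL, hLΓ⟩ := hΓ z
  have hsub : nbIn (templateGraph H Γ σ) univ (Sum.inl z) ⊆
      L.biUnion fun s => (nbIn H univ (σ s).2).image fun x => Sum.inr ((σ s).1, x) := by
    rintro (z | q) hq
    · exact (mem_nbIn.1 hq).2.elim
    · obtain ⟨s, h1, h2, h3⟩ := (mem_nbIn.1 hq).2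
      exact mem_biUnion.2 ⟨s, hLΓ s h3, mem_image.2 ⟨q.2, mem_nbIn.2 ⟨mem_univ _, h2.symm⟩,
        by rw [h1]⟩⟩
  calc _ ≤ _ := card_le_card hsub
    _ ≤ ∑ s ∈ L, ((nbIn H univ (σ s).2).image fun x => Sum.inr ((σ s).1, x)).card :=
        card_biUnion_le
    _ ≤ L.card • Δ :=
        Finset.sum_le_card_nsmul _ _ _ fun s _ => card_image_le.trans (hH _)
    _ ≤ d * Δ := by rw [smul_eq_mul]; exact Nat.mul_le_mul_right _ hL

/-- A small set `R` of vertices of high degree into a bi-dense set `Y` is covered by disjoint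
copies of `H` whose other vertices lie in `Y`. -/
lemma exists_cover [Fintype β] (H : SimpleGraph β) (K : SimpleGraph V) {Δ : ℕ}
    (hH : ∀ x, (nbIn H univ x).card ≤ Δ) {I : Finset β}
    (hI1 : ∀ x ∈ I, ∀ y ∈ I, ¬ H.Adj x y)
    (hI2 : ∀ z, ∀ x ∈ I, ∀ y ∈ I, H.Adj z x → H.Adj z y → x = y)
    {γ m θ : ℝ} (hγ : 0 < γ) (hγ1 : γ ≤ 1) (hm : 0 < m) (hθ1 : θ ≤ 1) {Y R : Finset V}
    (hY : DenseAbove K γ m Y) (hYR : Disjoint R Y)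
    (hdeg : ∀ v ∈ R, θ * Y.card ≤ (nbIn K Y v).card) {q : ℕ} (hq : R.card ≤ q * I.card)
    (h1 : 4 * (m + 1) ≤ (3 / 4 * γ) ^ Δ * (θ * Y.card))
    (h2 : (q * Fintype.card β : ℕ) + Δ * m ≤ (3 / 4 * γ) ^ Δ * (θ * Y.card)) :
    ∃ Φ : Fin q × β → V, Function.Injective Φ ∧ (∀ p, Φ p ∈ R ∨ Φ p ∈ Y) ∧ (∀ v ∈ R, ∃ p, Φ p = v) ∧
      ∀ c x y, H.Adj x y → K.Adj (Φ (c, x)) (Φ (c, y)) := by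
  classical
  obtain ⟨τ⟩ : Nonempty (R ↪ Fin q × I) := Function.Embedding.nonempty_of_card_le (by simpa using hq)
  set σ : R → Fin q × β := fun v => ((τ v).1, (τ v).2) with hσ
  have hσi : Function.Injective σ := by
    intro v w h
    have h := Prod.mk.inj h
    exact τ.injective (Prod.ext h.1 (Subtype.ext h.2))
  have hσI : ∀ v, (σ v).2 ∈ I := fun v => (τ v).2.2
  set F : SimpleGraph {p : Fin q × β // ∀ v, σ v ≠ p} := (copies (Fin q) H).comap Subtype.val
    with hF
  set C : {p : Fin q × β // ∀ v, σ v ≠ p} → Finset V := fun p => Y.filter fun u =>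
    ∀ v, (σ v).1 = p.1.1 → H.Adj p.1.2 (σ v).2 → K.Adj v u with hC
  have hFdeg : ∀ p, (nbIn F univ p).card ≤ Δ := by
    intro p
    refine (card_le_card_of_injOn (fun r => r.1.2) (t := nbIn H univ p.1.2) ?_ ?_).trans
      (hH p.1.2)
    · exact fun r hr => mem_nbIn.2 ⟨mem_univ _, (mem_nbIn.1 hr).2.2⟩
    · intro r hr r' hr' h
      exact Subtype.ext (Prod.ext ((mem_nbIn.1 hr).2.1.symm.trans (mem_nbIn.1 hr').2.1) h)
  have hCc : ∀ p, θ * Y.card ≤ (C p).card := by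
    intro p
    -- At most one vertex of `R` constrains `p`, so the candidates are either all of `Y` or the
    -- neighbourhood in `Y` of one high-degree vertex.
    by_cases hv : ∃ v, (σ v).1 = p.1.1 ∧ H.Adj p.1.2 (σ v).2
    · obtain ⟨v, hv1, hv2⟩ := hv
      refine (hdeg v v.2).trans (Nat.cast_le.2 (card_le_card fun u hu => ?_))
      refine mem_filter.2 ⟨(mem_nbIn.1 hu).1, fun w hw1 hw2 => ?_⟩
      have : w = v := hσi (Prod.ext (hw1.trans hv1.symm) (hI2 _ _ (hσI w) _ (hσI v) hw2 hv2))
      rw [this]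
      exact (mem_nbIn.1 hu).2
    · have : C p = Y := filter_true_of_mem fun u _ v hv1 hv2 => absurd ⟨v, hv1, hv2⟩ hv
      rw [this]
      have : (0 : ℝ) ≤ Y.card := Nat.cast_nonneg _
      nlinarith
  have hcard : (Fintype.card {p : Fin q × β // ∀ v, σ v ≠ p} : ℝ) ≤
      (q * Fintype.card β : ℕ) := by
    have := Fintype.card_subtype_le fun p : Fin q × β => ∀ v, σ v ≠ p
    rw [Fintype.card_prod, Fintype.card_fin] at this
    exact_mod_cast this
  obtain ⟨ψ, hψC, hψi, hψadj⟩ := exists_embedding_of_denseAbove (F := F) hγ hγ1 hm hY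
    (C := C) (fun p => filter_subset _ _) hCc ∅ (by simp) hFdeg (fun p _ => hFdeg p) h1
    (by linarith)
  have hψY : ∀ p, ψ p ∈ Y := fun p => (mem_filter.1 (hψC p)).1
  set Φ : Fin q × β → V := fun p => if h : ∃ v, σ v = p then (h.choose : V)
    else ψ ⟨p, fun v hv => h ⟨v, hv⟩⟩ with hΦ
  have hΦσ : ∀ v, Φ (σ v) = v := by
    intro v
    have h : ∃ w, σ w = σ v := ⟨v, rfl⟩
    simp only [hΦ, dif_pos h]
    exact congrArg Subtype.val (hσi h.choose_spec)
  have hΦψ : ∀ (p) (h : ∀ v, σ v ≠ p), Φ p = ψ ⟨p, h⟩ := by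
    intro p h
    have h' : ¬ ∃ v, σ v = p := fun ⟨v, hv⟩ => h v hv
    simp only [hΦ, dif_neg h']
  have hcases : ∀ p, (∃ v, σ v = p) ∨ ∀ v, σ v ≠ p := fun p => by
    by_cases h : ∃ v, σ v = p
    · exact Or.inl h
    · exact Or.inr fun v hv => h ⟨v, hv⟩
  refine ⟨Φ, ?_, ?_, fun v hv => ⟨σ ⟨v, hv⟩, hΦσ _⟩, ?_⟩
  · intro p p' h
    rcases hcases p with ⟨v, rfl⟩ | hp <;> rcases hcases p' with ⟨w, rfl⟩ | hp'
    · rw [hΦσ, hΦσ] at h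
      rw [Subtype.ext h]
    · rw [hΦσ, hΦψ p' hp'] at h
      exact absurd (h ▸ hψY _) (disjoint_left.1 hYR v.2)
    · rw [hΦσ, hΦψ p hp] at h
      exact absurd (h ▸ hψY _) (disjoint_left.1 hYR w.2)
    · rw [hΦψ p hp, hΦψ p' hp'] at h
      exact congrArg Subtype.val (hψi h)
  · intro p
    rcases hcases p with ⟨v, rfl⟩ | hp
    · rw [hΦσ]; exact Or.inl v.2
    · rw [hΦψ p hp]; exact Or.inr (hψY _)
  · have hmixed : ∀ v c y, (σ v).1 = c → H.Adj y (σ v).2 → K.Adj (v : V) (Φ (c, y)) := by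
      intro v c y hc hy
      have hp : ∀ w, σ w ≠ (c, y) := fun w hw => by
        have hyI := hσI w
        rw [hw] at hyI
        exact hI1 y hyI _ (hσI v) hy
      rw [hΦψ _ hp]
      exact (mem_filter.1 (hψC ⟨(c, y), hp⟩)).2 v hc hy
    intro c x y hxy
    rcases hcases (c, x) with ⟨v, hv⟩ | hp
    · have h := hmixed v c y (by rw [hv]) (by rw [hv]; exact hxy.symm)
      rwa [← hΦσ v, hv] at h
    · rcases hcases (c, y) with ⟨w, hw⟩ | hp'
      · have h := hmixed w c x (by rw [hw]) (by rw [hw]; exact hxy)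
        rw [← hΦσ w, hw] at h
        exact h.symm
      · rw [hΦψ _ hp, hΦψ _ hp']
        exact hψadj _ _ ⟨rfl, hxy⟩

/-- Filling all slots of an embedded template graph yields disjoint copies of `H`. -/
lemma exists_filled_copies {Z S J : Type*} (H : SimpleGraph β) (K : SimpleGraph V) {I : Finset β}
    (hI1 : ∀ x ∈ I, ∀ y ∈ I, ¬ H.Adj x y) (Γ : S → Z → Prop) (σ : S → J × β)
    (hσ : Function.Injective σ) (hσI : ∀ s, (σ s).2 ∈ I) (φ : Z ⊕ J × β → V)
    (hφ : Function.Injective φ)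
    (hadj : ∀ a b, (templateGraph H Γ σ).Adj a b → K.Adj (φ a) (φ b))
    (g : S → Z) (hg : Function.Injective g) (hgΓ : ∀ s, Γ s (g s)) :
    ∃ Φ : J × β → V, Function.Injective Φ ∧
      (∀ p, (∃ s, Φ p = φ (Sum.inl (g s))) ∨ (∀ s, σ s ≠ p) ∧ Φ p = φ (Sum.inr p)) ∧
      ∀ c x y, H.Adj x y → K.Adj (Φ (c, x)) (Φ (c, y)) := by
  classical
  set Φ : J × β → V := fun p => if h : ∃ s, σ s = p then φ (Sum.inl (g h.choose))
    else φ (Sum.inr p) with hΦ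
  have hΦσ : ∀ s, Φ (σ s) = φ (Sum.inl (g s)) := by
    intro s
    have h : ∃ w, σ w = σ s := ⟨s, rfl⟩
    simp only [hΦ, dif_pos h]
    rw [hσ h.choose_spec]
  have hΦn : ∀ p, (∀ s, σ s ≠ p) → Φ p = φ (Sum.inr p) := by
    intro p h
    have h' : ¬ ∃ v, σ v = p := fun ⟨v, hv⟩ => h v hv
    simp only [hΦ, dif_neg h']
  have hcases : ∀ p, (∃ v, σ v = p) ∨ ∀ v, σ v ≠ p := fun p => by
    by_cases h : ∃ v, σ v = p
    · exact Or.inl h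
    · exact Or.inr fun v hv => h ⟨v, hv⟩
  refine ⟨Φ, ?_, ?_, ?_⟩
  · intro p p' h
    rcases hcases p with ⟨v, rfl⟩ | hp <;> rcases hcases p' with ⟨w, rfl⟩ | hp'
    · rw [hΦσ, hΦσ] at h
      rw [hg (Sum.inl.inj (hφ h))]
    · rw [hΦσ, hΦn p' hp'] at h
      cases hφ h
    · rw [hΦσ, hΦn p hp] at h
      cases hφ h
    · rw [hΦn p hp, hΦn p' hp'] at h
      exact Sum.inr.inj (hφ h)
  · intro p
    rcases hcases p with ⟨v, rfl⟩ | hp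
    · exact Or.inl ⟨v, hΦσ v⟩
    · exact Or.inr ⟨hp, hΦn p hp⟩
  · have hmixed : ∀ s c y, (σ s).1 = c → H.Adj y (σ s).2 → K.Adj (Φ (σ s)) (Φ (c, y)) := by
      intro s c y hc hy
      have hp : ∀ w, σ w ≠ (c, y) := fun w hw => by
        have hyI := hσI w
        rw [hw] at hyI
        exact hI1 y hyI _ (hσI s) hy
      rw [hΦn _ hp, hΦσ]
      exact hadj _ _ ⟨s, hc, hy, hgΓ s⟩
    intro c x y hxy
    rcases hcases (c, x) with ⟨v, hv⟩ | hp
    · have h := hmixed v c y (by rw [hv]) (by rw [hv]; exact hxy.symm)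
      rwa [hv] at h
    · rcases hcases (c, y) with ⟨w, hw⟩ | hp'
      · have h := hmixed w c x (by rw [hw]) (by rw [hw]; exact hxy)
        rw [hw] at h
        exact h.symm
      · rw [hΦn _ hp, hΦn _ hp']
        exact hadj _ _ ⟨rfl, hxy, hp, hp'⟩

/-- A large bi-dense set contains a set `A` that absorbs every small set of vertices having high
degree into a certain subset `Y` of `A`. -/
theorem exists_absorber_of_denseAbove [Fintype β] [Nonempty β] (H : SimpleGraph β)
    (K : SimpleGraph V) {Δ ρ n : ℕ} (hΔ : 1 ≤ Δ) (hH : ∀ x, (nbIn H univ x).card ≤ Δ)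
    {γ m θ : ℝ} (hγ : 0 < γ) (hγ1 : γ ≤ 1) (hm : 0 < m) (hθ0 : 0 ≤ θ) (hθ1 : θ ≤ 1) {B : Finset V}
    (hB : DenseAbove K γ m B)
    (c1 : 4 * (m + 1) ≤ (3 / 4 * γ) ^ (Δ + 2) * B.card)
    (c2 : (128 * n * (Δ ^ 2 + 2) + Fintype.card β : ℕ) + (64 * Δ : ℕ) * m ≤
      (3 / 4 * γ) ^ (Δ + 2) * B.card)
    (c3 : 4 * (m + 1) ≤ (3 / 4 * γ) ^ Δ * (θ * n))
    (c4 : ((Δ ^ 2 + 2) * ρ + Fintype.card β : ℕ) + Δ * m ≤ (3 / 4 * γ) ^ Δ * (θ * n)) :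
    ∃ Y A : Finset V, Y ⊆ A ∧ A ⊆ B ∧ Y.card = n ∧
      ∀ R : Finset V, Disjoint R A → R.card ≤ ρ →
        (∀ v ∈ R, θ * Y.card ≤ (nbIn K Y v).card) →
        HasTiling H (K.induce ((A : Set V) ∪ (R : Set V))) := by
  classical
  set h := Fintype.card β with hh
  have hpos : 0 < h := Fintype.card_pos
  have hnle : (3 / 4 * γ) ^ Δ * (θ * n) ≤ n := by
    have h1 : (3 / 4 * γ) ^ Δ ≤ 1 := pow_le_one₀ (by positivity) (by linarith)
    have h2 : θ * n ≤ n := by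
      have : (0 : ℝ) ≤ n := Nat.cast_nonneg n
      nlinarith
    have h3 : 0 ≤ θ * n := by positivity
    nlinarith
  have hDn : (Δ ^ 2 + 2) * ρ + h ≤ n := by
    have : (0 : ℝ) ≤ Δ * m := by positivity
    have : (((Δ ^ 2 + 2) * ρ + h : ℕ) : ℝ) ≤ n := by linarith
    exact_mod_cast this
  -- Large enough that `⌊(|R| + D₀) / h⌋` copies of `H` offer a vertex of `I` to each element of
  -- `R`; the extra `h` pays for rounding.
  set D₀ := (Δ ^ 2 + 1) * ρ + h with hD₀
  have hD₀n : D₀ ≤ n := by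
    refine le_trans ?_ hDn
    rw [hD₀]
    gcongr
    omega
  obtain ⟨I, hI1, hI2, hIc⟩ := exists_two_independent H hH
  have hI0 : 0 < I.card := by
    rcases Nat.eq_zero_or_pos I.card with h0 | h0
    · rw [h0, zero_mul] at hIc; omega
    · exact h0
  obtain ⟨Z, S, _, _, Γ, y, hy, hSZ, hZn, hΓ3, hΓ64, hmatch⟩ :=
    exists_template (n := n) (D₀ := D₀) (by omega) hD₀n
  set nP := Fintype.card S / I.card + 1 with hnP
  obtain ⟨τ⟩ : Nonempty (S ↪ Fin nP × I) := Function.Embedding.nonempty_of_card_le (by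
    rw [Fintype.card_prod, Fintype.card_fin, Fintype.card_coe, hnP]
    exact (Nat.lt_mul_of_div_lt (Nat.lt_succ_self _) hI0).le)
  set σ : S → Fin nP × β := fun s => ((τ s).1, (τ s).2) with hσ
  have hσi : Function.Injective σ := by
    intro v w h
    have h := Prod.mk.inj h
    exact τ.injective (Prod.ext h.1 (Subtype.ext h.2))
  have hσI : ∀ v, (σ v).2 ∈ I := fun v => (τ v).2.2
  have hnPh : nP * h ≤ Fintype.card S * (Δ ^ 2 + 1) + h := by
    rw [hnP, add_mul, one_mul]
    refine Nat.add_le_add_right ?_ _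
    calc Fintype.card S / I.card * h ≤ Fintype.card S / I.card * (I.card * (Δ ^ 2 + 1)) :=
          Nat.mul_le_mul_left _ hIc
      _ = Fintype.card S / I.card * I.card * (Δ ^ 2 + 1) := by ring
      _ ≤ _ := Nat.mul_le_mul_right _ (Nat.div_mul_le_self _ _)
  have hdegr := card_nbIn_templateGraph_inr H hH hI2 Γ σ hσi hσI hΓ3
  have hdegl := card_nbIn_templateGraph_inl H hH Γ σ hΓ64
  -- The fillers form an independent set and are embedded first, so their degree `64Δ` enters only
  -- linearly; the exponent is `Δ + 2`.
  obtain ⟨φ, hφB, hφi, hφadj⟩ := exists_embedding_of_denseAbove (F := templateGraph H Γ σ)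
    (c := B.card) (a := 64 * Δ) (b := Δ + 2) hγ hγ1 hm hB (C := fun _ => B)
    (fun _ => subset_rfl) (fun _ => le_rfl) (univ.image Sum.inl)
    (by
      intro a ha b hb
      obtain ⟨z, -, rfl⟩ := mem_image.1 ha
      obtain ⟨z', -, rfl⟩ := mem_image.1 hb
      exact fun h => h)
    (by
      rintro (z | p)
      · exact hdegl z
      · exact (hdegr p).trans (by omega))
    (by
      rintro (z | p) hz
      · exact absurd (mem_image.2 ⟨z, mem_univ _, rfl⟩) hz
      · exact hdegr p)
    c1
    (by
      refine le_trans (add_le_add_left (Nat.cast_le.2 ?_) _) c2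
      rw [Fintype.card_sum, Fintype.card_prod, Fintype.card_fin, ← hh]
      have : Fintype.card S ≤ 128 * n := by omega
      nlinarith)
  set Y : Finset V := univ.image fun i => φ (Sum.inl (y i)) with hYdef
  have hyi : Function.Injective fun i => φ (Sum.inl (y i)) := fun i j h =>
    hy (Sum.inl.inj (hφi h))
  -- The slot positions themselves were embedded only as placeholders and are dropped. This gives
  -- `|A| = |Z| - |S| + nP·h = D₀ + nP·h`.
  set N : Finset (Z ⊕ Fin nP × β) := (univ.image fun s => Sum.inr (σ s))ᶜ with hN
  set A : Finset V := N.image φ with hA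
  have hNl : ∀ z, Sum.inl z ∈ N := fun z => by simp [hN]
  have hNr : ∀ p, (∀ s, σ s ≠ p) → Sum.inr p ∈ N := fun p hp => by simpa [hN] using hp
  have hYA : Y ⊆ A := by
    intro v hv
    obtain ⟨i, -, rfl⟩ := mem_image.1 hv
    exact mem_image_of_mem φ (hNl _)
  have hAB : A ⊆ B := by
    intro v hv
    obtain ⟨a, -, rfl⟩ := mem_image.1 hv
    exact hφB a
  have hYc : Y.card = n := by rw [hYdef, card_image_of_injective _ hyi]; simp
  have hAc : A.card = D₀ + nP * h := by
    rw [hA, card_image_of_injective _ hφi, hN, card_compl,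
      card_image_of_injective _ fun s t h => hσi (Sum.inr.inj h), card_univ, Fintype.card_sum,
      Fintype.card_prod, Fintype.card_fin, ← hh]
    omega
  refine ⟨Y, A, hYA, hAB, hYc, fun R hRA hRρ hRdeg => ?_⟩
  -- The `nP` template copies leave `|R| + D₀` vertices to treat. Using the maximal number `q` of
  -- further copies leaves exactly the remainder that a tiling permits.
  set q := (R.card + D₀) / h with hq
  have hqmod : R.card + D₀ = h * q + (R.card + D₀) % h := (Nat.div_add_mod _ _).symm
  have hmodlt : (R.card + D₀) % h < h := Nat.mod_lt _ hpos
  have hqI : R.card ≤ q * I.card := by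
    have h1 : h * q ≤ q * I.card * (Δ ^ 2 + 1) := by
      calc h * q ≤ (I.card * (Δ ^ 2 + 1)) * q := Nat.mul_le_mul_right _ hIc
        _ = _ := by ring
    have h2 : (Δ ^ 2 + 1) * R.card ≤ (Δ ^ 2 + 1) * ρ := Nat.mul_le_mul_left _ hRρ
    have h3 : R.card * (Δ ^ 2 + 1) ≤ q * I.card * (Δ ^ 2 + 1) := by
      rw [mul_comm]
      omega
    exact Nat.le_of_mul_le_mul_right h3 (by positivity)
  have hqh : q * h ≤ (Δ ^ 2 + 2) * ρ + h := by
    have : (Δ ^ 2 + 2) * ρ = (Δ ^ 2 + 1) * ρ + ρ := by ring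
    rw [mul_comm q h]
    omega
  obtain ⟨Φ₂, hΦ₂i, hΦ₂R, hRΦ₂, hΦ₂adj⟩ := exists_cover H K hH hI1 hI2 hγ hγ1 hm hθ1
    (hB.subset (hYA.trans hAB)) (disjoint_of_subset_right hYA hRA) hRdeg hqI
    (by rw [hYc]; exact c3)
    (by
      rw [hYc]
      refine le_trans (add_le_add_left (Nat.cast_le.2 hqh) _) c4)
  have hRY : Disjoint R Y := disjoint_of_subset_right hYA hRA
  set D' : Finset (Fin n) := univ.filter fun i => ∃ p, Φ₂ p = φ (Sum.inl (y i)) with hD'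
  have hD'c : D'.card ≤ D₀ := by
    have hsub : R ∪ D'.image (fun i => φ (Sum.inl (y i))) ⊆ univ.image Φ₂ := by
      intro v hv
      rcases mem_union.1 hv with hv | hv
      · obtain ⟨p, hp⟩ := hRΦ₂ v hv
        exact mem_image.2 ⟨p, mem_univ _, hp⟩
      · obtain ⟨i, hi, rfl⟩ := mem_image.1 hv
        obtain ⟨p, hp⟩ := (mem_filter.1 hi).2
        exact mem_image.2 ⟨p, mem_univ _, hp⟩
    have h1 := card_le_card hsub
    rw [card_union_of_disjoint, card_image_of_injective _ hyi, card_image_of_injective _ hΦ₂i,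
      card_univ, Fintype.card_prod, Fintype.card_fin, ← hh, mul_comm q h] at h1
    · omega
    · refine disjoint_of_subset_right ?_ hRY
      exact image_subset_image (subset_univ _)
  -- The template needs exactly `D₀` deletions; the fillers added here to those already used remain
  -- uncovered.
  obtain ⟨D, hD'D, hDc⟩ := exists_superset_card_eq hD'c (by rw [Fintype.card_fin]; exact hD₀n)
  obtain ⟨g, hg, hgΓ, hgD⟩ := hmatch D hDc
  obtain ⟨Φ₁, hΦ₁i, hΦ₁, hΦ₁adj⟩ := exists_filled_copies H K hI1 Γ σ hσi hσI φ hφi hφadj g hg hgΓ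
  have hΦ₁A : ∀ p, Φ₁ p ∈ A := by
    intro p
    rcases hΦ₁ p with ⟨s, hs⟩ | ⟨hp, hs⟩
    · rw [hs]; exact mem_image_of_mem φ (hNl _)
    · rw [hs]; exact mem_image_of_mem φ (hNr p hp)
  have hne : ∀ p p', Φ₁ p ≠ Φ₂ p' := by
    intro p p' hpp
    rcases hΦ₂R p' with hR | hY'
    · exact disjoint_left.1 hRA hR (hpp ▸ hΦ₁A p)
    · obtain ⟨i, -, hi⟩ := mem_image.1 hY'
      have hiD : i ∈ D := hD'D (mem_filter.2 ⟨mem_univ _, p', hi.symm⟩)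
      rw [← hi] at hpp
      rcases hΦ₁ p with ⟨s, hs⟩ | ⟨-, hs⟩
      · rw [hs] at hpp
        exact hgD s i hiD (Sum.inl.inj (hφi hpp))
      · rw [hs] at hpp
        cases hφi hpp
  rw [← coe_union]
  refine hasTiling_of_family (ι := Fin nP ⊕ Fin q) H K (A ∪ R)
    (fun p => Sum.elim (fun c => Φ₁ (c, p.2)) (fun c => Φ₂ (c, p.2)) p.1) ?_ ?_ ?_
    (r := (R.card + D₀) % h) ?_ hmodlt
  · rintro ⟨c | c, x⟩ ⟨c' | c', x'⟩ h
    · have h := Prod.mk.inj (hΦ₁i h)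
      exact Prod.ext (congrArg Sum.inl h.1) h.2
    · exact absurd h (hne _ _)
    · exact absurd h.symm (hne _ _)
    · have h := Prod.mk.inj (hΦ₂i h)
      exact Prod.ext (congrArg Sum.inr h.1) h.2
  · rintro ⟨c | c, x⟩
    · exact mem_union_left _ (hΦ₁A _)
    · rcases hΦ₂R (c, x) with h | h
      · exact mem_union_right _ h
      · exact mem_union_left _ (hYA h)
  · rintro (c | c) x x' hxx
    · exact hΦ₁adj c x x' hxx
    · exact hΦ₂adj c x x' hxx
  · rw [card_union_of_disjoint hRA.symm, hAc, Fintype.card_sum, Fintype.card_fin, Fintype.card_fin,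
      ← hh, add_mul nP q, mul_comm q h]
    omega

end Absorber

/-! ### Comparison of all bounds with powers of two. -/

section Numerics

lemma two_rpow_logb {Δ : ℕ} (hΔ : 2 ≤ Δ) : (Δ : ℝ) = 2 ^ Real.logb 2 (Δ : ℝ) := by
  rw [Real.rpow_logb (by norm_num) (by norm_num)]
  exact_mod_cast (by omega : 0 < Δ)

lemma one_le_logb {Δ : ℕ} (hΔ : 2 ≤ Δ) : 1 ≤ Real.logb 2 (Δ : ℝ) := by
  have : (0 : ℝ) < Δ := by exact_mod_cast (by omega : 0 < Δ)
  rw [Real.le_logb_iff_rpow_le (by norm_num) this, Real.rpow_one]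
  exact_mod_cast hΔ

lemma eight_mul_le_two_pow_clog (Δ : ℕ) : 8 * Δ ≤ 2 ^ (Nat.clog 2 Δ + 3) := by
  have := Nat.le_pow_clog (b := 2) (by norm_num) Δ
  rw [pow_add]
  omega

/-- `clog + 3` is the depth of the sparse-pair recursion. Equality holds at `Δ = 2`; from 3 on,
`clog ≤ log + 1` and `3 log Δ ≥ log 27 > 4`. -/
lemma clog_add_three_le {Δ : ℕ} (hΔ : 2 ≤ Δ) :
    ((Nat.clog 2 Δ + 3 : ℕ) : ℝ) ≤ 4 * Real.logb 2 (Δ : ℝ) := by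
  have hpos : (0 : ℝ) < Δ := by exact_mod_cast (by omega : 0 < Δ)
  rcases Nat.lt_or_ge Δ 3 with h | h
  · have : Δ = 2 := by omega
    subst this
    have : Nat.clog 2 2 = 1 := Nat.clog_eq_one le_rfl le_rfl
    rw [this]
    norm_num
  · have h1 : 2 ^ (Nat.clog 2 Δ - 1) < Δ := Nat.pow_pred_clog_lt_self (by norm_num) (by omega)
    have h2 : ((Nat.clog 2 Δ - 1 : ℕ) : ℝ) ≤ Real.logb 2 Δ := by
      rw [Real.le_logb_iff_rpow_le (by norm_num) hpos, Real.rpow_natCast]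
      exact_mod_cast h1.le
    have h3 : (4 : ℝ) ≤ 3 * Real.logb 2 Δ := by
      have : (3 : ℝ) * Real.logb 2 Δ = Real.logb 2 ((Δ : ℝ) ^ 3) := by
        rw [Real.logb_pow]; norm_num
      rw [this, Real.le_logb_iff_rpow_le (by norm_num) (by positivity)]
      have h3 : (3 : ℝ) ≤ Δ := by exact_mod_cast h
      have : (3 : ℝ) ^ 3 ≤ (Δ : ℝ) ^ 3 := by gcongr
      norm_num at this ⊢
      linarith
    have h4 : Nat.clog 2 Δ ≤ (Nat.clog 2 Δ - 1) + 1 := by omega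
    have h5 : (Nat.clog 2 Δ : ℝ) ≤ (Nat.clog 2 Δ - 1 : ℕ) + 1 := by exact_mod_cast h4
    push_cast
    linarith

variable {Δ h : ℕ}

lemma sixteen_mul_pow (hΔ : 2 ≤ Δ) (j : ℕ) :
    (16 * Δ : ℝ) ^ j = 2 ^ ((4 + Real.logb 2 (Δ : ℝ)) * j) := by
  rw [Real.rpow_mul (by norm_num), Real.rpow_natCast, Real.rpow_add (by norm_num),
    ← two_rpow_logb hΔ]
  norm_num

lemma two_rpow_pow_le {t s : ℝ} (hh : (h : ℝ) ≤ 4 * s) (ht : 0 ≤ t) :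
    ((2 : ℝ) ^ t) ^ h ≤ 2 ^ (t * (4 * s)) := by
  rw [← Real.rpow_natCast, ← Real.rpow_mul (by norm_num)]
  exact Real.rpow_le_rpow_of_exponent_le (by norm_num) (mul_le_mul_of_nonneg_left hh ht)

/-- The basic inequalities between the monomials in `Δ` and `log Δ`. -/
lemma monomial_bounds {D s : ℝ} (hD : 2 ≤ D) (hs : 1 ≤ s) :
    2 ≤ D * s ∧ D ≤ D * s ∧ 2 * s ≤ D * s ∧ D * s ≤ D * s ^ 2 := by
  refine ⟨by nlinarith, by nlinarith, by nlinarith, ?_⟩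
  have : 0 ≤ D * s * (s - 1) := by
    have : 0 ≤ s - 1 := by linarith
    positivity
  nlinarith

lemma ramsey_bound_numeric (hΔ : 2 ≤ Δ) (hh : (h : ℝ) ≤ 4 * Real.logb 2 (Δ : ℝ)) :
    ((48 * Δ * (16 * Δ) ^ Δ) ^ h * (16 * Δ * (16 * Δ) ^ Δ) : ℝ) ≤
      2 ^ (42 * ((Δ : ℝ) * Real.logb 2 (Δ : ℝ) ^ 2)) := by
  set s := Real.logb 2 (Δ : ℝ) with hs
  have hs1 : 1 ≤ s := one_le_logb hΔ
  have hD : (2 : ℝ) ≤ Δ := by exact_mod_cast hΔ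
  obtain ⟨m1, m2, m3, m4⟩ := monomial_bounds hD hs1
  have e1 : (48 * Δ * (16 * Δ) ^ Δ : ℝ) ≤ 2 ^ (17 / 2 * (Δ * s)) := by
    have h48 : (48 : ℝ) ≤ 2 ^ (6 : ℝ) := by norm_num
    calc (48 * Δ * (16 * Δ) ^ Δ : ℝ) ≤ 2 ^ (6 : ℝ) * 2 ^ s * 2 ^ ((4 + s) * Δ) := by
          rw [sixteen_mul_pow hΔ, ← two_rpow_logb hΔ]
          gcongr
      _ = 2 ^ (6 + s + (4 + s) * Δ) := by
          rw [Real.rpow_add (by norm_num), Real.rpow_add (by norm_num)]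
      _ ≤ _ := Real.rpow_le_rpow_of_exponent_le (by norm_num) (by nlinarith)
  have e2 : (16 * Δ * (16 * Δ) ^ Δ : ℝ) ≤ 2 ^ (15 / 2 * (Δ * s)) := by
    have h16 : (16 : ℝ) ≤ 2 ^ (4 : ℝ) := by norm_num
    calc (16 * Δ * (16 * Δ) ^ Δ : ℝ) ≤ 2 ^ (4 : ℝ) * 2 ^ s * 2 ^ ((4 + s) * Δ) := by
          rw [sixteen_mul_pow hΔ, ← two_rpow_logb hΔ]
          gcongr
      _ = 2 ^ (4 + s + (4 + s) * Δ) := by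
          rw [Real.rpow_add (by norm_num), Real.rpow_add (by norm_num)]
      _ ≤ _ := Real.rpow_le_rpow_of_exponent_le (by norm_num) (by nlinarith)
  calc _ ≤ ((2 : ℝ) ^ (17 / 2 * (Δ * s))) ^ h * 2 ^ (15 / 2 * (Δ * s)) := by gcongr
    _ ≤ 2 ^ (17 / 2 * (Δ * s) * (4 * s)) * 2 ^ (15 / 2 * (Δ * s)) := by
        gcongr
        exact two_rpow_pow_le hh (by positivity)
    _ = 2 ^ (17 / 2 * (Δ * s) * (4 * s) + 15 / 2 * (Δ * s)) := by
        rw [← Real.rpow_add (by norm_num)]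
    _ ≤ _ := Real.rpow_le_rpow_of_exponent_le (by norm_num) (by nlinarith)

/-- The exponent is `27·4 + 26 = 134`. Together with 42 from the Ramsey bound it gives 176, below
the 200 allowed for the absorber. -/
lemma absorber_bound_numeric (hΔ : 2 ≤ Δ) (hh : (h : ℝ) ≤ 4 * Real.logb 2 (Δ : ℝ)) :
    ((96 * Δ * (512 * Δ ^ 2 * (16 * Δ) ^ (Δ + 2)) * (16 * Δ) ^ (Δ + 1)) ^ h *
      (512 * Δ ^ 2 * (16 * Δ) ^ (Δ + 2) * (8 * Δ ^ 2 * (16 * Δ) ^ (Δ + 1))) : ℝ) ≤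
      2 ^ (134 * ((Δ : ℝ) * Real.logb 2 (Δ : ℝ) ^ 2)) := by
  set s := Real.logb 2 (Δ : ℝ) with hs
  have hs1 : 1 ≤ s := one_le_logb hΔ
  have hD : (2 : ℝ) ≤ Δ := by exact_mod_cast hΔ
  obtain ⟨m1, m2, m3, m4⟩ := monomial_bounds hD hs1
  have hT : ((16 * Δ) ^ (Δ + 2) * (16 * Δ) ^ (Δ + 1) : ℝ) = 2 ^ ((4 + s) * (2 * Δ + 3)) := by
    rw [sixteen_mul_pow hΔ, sixteen_mul_pow hΔ, ← Real.rpow_add (by norm_num)]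
    congr 1
    push_cast
    ring
  have hΔ3 : ((Δ : ℝ)) ^ 3 = 2 ^ (3 * s) := by
    rw [mul_comm, Real.rpow_mul (by norm_num), ← two_rpow_logb hΔ]
    norm_num
  have hΔ4 : ((Δ : ℝ)) ^ 4 = 2 ^ (4 * s) := by
    rw [mul_comm, Real.rpow_mul (by norm_num), ← two_rpow_logb hΔ]
    norm_num
  have e1 : (96 * Δ * (512 * Δ ^ 2 * (16 * Δ) ^ (Δ + 2)) * (16 * Δ) ^ (Δ + 1) : ℝ) ≤
      2 ^ (27 * (Δ * s)) := by
    have h48 : (96 * 512 : ℝ) ≤ 2 ^ (16 : ℝ) := by norm_num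
    calc (96 * Δ * (512 * Δ ^ 2 * (16 * Δ) ^ (Δ + 2)) * (16 * Δ) ^ (Δ + 1) : ℝ)
        = 96 * 512 * (Δ : ℝ) ^ 3 * ((16 * Δ) ^ (Δ + 2) * (16 * Δ) ^ (Δ + 1)) := by ring
      _ ≤ 2 ^ (16 : ℝ) * 2 ^ (3 * s) * 2 ^ ((4 + s) * (2 * Δ + 3)) := by
          rw [hT, hΔ3]
          gcongr
      _ = 2 ^ (16 + 3 * s + (4 + s) * (2 * Δ + 3)) := by
          rw [Real.rpow_add (by norm_num), Real.rpow_add (by norm_num)]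
      _ ≤ _ := Real.rpow_le_rpow_of_exponent_le (by norm_num) (by nlinarith)
  have e2 : (512 * Δ ^ 2 * (16 * Δ) ^ (Δ + 2) * (8 * Δ ^ 2 * (16 * Δ) ^ (Δ + 1)) : ℝ) ≤
      2 ^ (26 * (Δ * s)) := by
    have h16 : (512 * 8 : ℝ) ≤ 2 ^ (12 : ℝ) := by norm_num
    calc (512 * Δ ^ 2 * (16 * Δ) ^ (Δ + 2) * (8 * Δ ^ 2 * (16 * Δ) ^ (Δ + 1)) : ℝ)
        = 512 * 8 * (Δ : ℝ) ^ 4 * ((16 * Δ) ^ (Δ + 2) * (16 * Δ) ^ (Δ + 1)) := by ring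
      _ ≤ 2 ^ (12 : ℝ) * 2 ^ (4 * s) * 2 ^ ((4 + s) * (2 * Δ + 3)) := by
          rw [hT, hΔ4]
          gcongr
      _ = 2 ^ (12 + 4 * s + (4 + s) * (2 * Δ + 3)) := by
          rw [Real.rpow_add (by norm_num), Real.rpow_add (by norm_num)]
      _ ≤ _ := Real.rpow_le_rpow_of_exponent_le (by norm_num) (by nlinarith)
  calc _ ≤ ((2 : ℝ) ^ (27 * (Δ * s))) ^ h * 2 ^ (26 * (Δ * s)) := by gcongr
    _ ≤ 2 ^ (27 * (Δ * s) * (4 * s)) * 2 ^ (26 * (Δ * s)) := by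
        gcongr
        exact two_rpow_pow_le hh (by positivity)
    _ = 2 ^ (27 * (Δ * s) * (4 * s) + 26 * (Δ * s)) := by
        rw [← Real.rpow_add (by norm_num)]
    _ ≤ _ := Real.rpow_le_rpow_of_exponent_le (by norm_num) (by nlinarith)

lemma dense_set_numeric (hΔ : 2 ≤ Δ) (hh : (h : ℝ) ≤ 4 * Real.logb 2 (Δ : ℝ)) :
    ((6 * (2 ^ (10 * Δ + 11) * Δ ^ (2 * Δ + 4))) ^ h * 4 ^ (Δ + 1) : ℝ) ≤
      2 ^ (87 * ((Δ : ℝ) * Real.logb 2 (Δ : ℝ) ^ 2)) := by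
  set s := Real.logb 2 (Δ : ℝ) with hs
  have hs1 : 1 ≤ s := one_le_logb hΔ
  have hD : (2 : ℝ) ≤ Δ := by exact_mod_cast hΔ
  obtain ⟨m1, m2, m3, m4⟩ := monomial_bounds hD hs1
  have h2 : (2 : ℝ) ^ (10 * Δ + 11) = 2 ^ (10 * (Δ : ℝ) + 11) := by
    rw [← Real.rpow_natCast]; push_cast; rfl
  have hΔp : (Δ : ℝ) ^ (2 * Δ + 4) = 2 ^ (s * (2 * Δ + 4)) := by
    rw [Real.rpow_mul (by norm_num), ← two_rpow_logb hΔ, ← Real.rpow_natCast]; push_cast; rfl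
  have h4 : (4 : ℝ) ^ (Δ + 1) = 2 ^ (2 * ((Δ : ℝ) + 1)) := by
    rw [Real.rpow_mul (by norm_num), ← Real.rpow_natCast]; push_cast; norm_num
  have e1 : (6 * (2 ^ (10 * Δ + 11) * Δ ^ (2 * Δ + 4)) : ℝ) ≤ 2 ^ (21 * (Δ * s)) := by
    have h6 : (6 : ℝ) ≤ 2 ^ (3 : ℝ) := by norm_num
    calc (6 * (2 ^ (10 * Δ + 11) * Δ ^ (2 * Δ + 4)) : ℝ)
        ≤ 2 ^ (3 : ℝ) * (2 ^ (10 * (Δ : ℝ) + 11) * 2 ^ (s * (2 * Δ + 4))) := by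
          rw [h2, hΔp]; gcongr
      _ = 2 ^ (3 + (10 * (Δ : ℝ) + 11 + s * (2 * Δ + 4))) := by
          rw [← Real.rpow_add (by norm_num), ← Real.rpow_add (by norm_num)]
      _ ≤ _ := Real.rpow_le_rpow_of_exponent_le (by norm_num) (by nlinarith)
  calc _ ≤ ((2 : ℝ) ^ (21 * (Δ * s))) ^ h * 2 ^ (2 * ((Δ : ℝ) + 1)) := by
        rw [h4]; gcongr
    _ ≤ 2 ^ (21 * (Δ * s) * (4 * s)) * 2 ^ (2 * ((Δ : ℝ) + 1)) := by
        gcongr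
        exact two_rpow_pow_le hh (by positivity)
    _ = 2 ^ (21 * (Δ * s) * (4 * s) + 2 * ((Δ : ℝ) + 1)) := by
        rw [← Real.rpow_add (by norm_num)]
    _ ≤ _ := Real.rpow_le_rpow_of_exponent_le (by norm_num) (by nlinarith)

end Numerics

/-! ### Choice of parameters and assembly. -/

section Main

variable {α β V : Type*}

lemma card_nbIn_le_of_maxDegree_le [Fintype α] (G : SimpleGraph α) [DecidableRel G.Adj] {Δ : ℕ}
    (hG : G.maxDegree ≤ Δ) (x : α) : (nbIn G univ x).card ≤ Δ := by
  refine le_trans (le_of_eq ?_) ((G.degree_le_maxDegree x).trans hG)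
  rw [← SimpleGraph.card_neighborFinset_eq_degree]
  congr 1
  ext y
  simp [mem_nbIn]

lemma card_interedges_eq_edgeCount (K : SimpleGraph V) [DecidableRel K.Adj] (X Y : Finset V) :
    (K.interedges X Y).card = edgeCount K X Y := by
  classical
  rw [SimpleGraph.interedges, Rel.interedges, card_filter, sum_product, edgeCount]
  refine Finset.sum_congr rfl fun x _ => ?_
  rw [nbIn, card_filter]
  refine Finset.sum_congr rfl fun y _ => ?_
  congr

/-- Nonemptiness of `U` excludes empty pairs, whose edge density is zero by convention. -/
lemma isBiDense_of_denseAbove (K : SimpleGraph V) [DecidableRel K.Adj] {ε γ γ' : ℝ} (hε : 0 < ε)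
    (hγ : γ' ≤ γ) {U : Finset V} (hU : U.Nonempty) (h : DenseAbove K γ (ε * U.card) U) :
    IsBiDense K ε γ' U := by
  intro X Y hX hY hXY hXc hYc
  have hUpos : (0 : ℝ) < ε * U.card := by
    have : (0 : ℝ) < U.card := by exact_mod_cast card_pos.2 hU
    positivity
  have h1 := h X hX Y hY hXY hXc hYc
  have hXp := hUpos.trans_le hXc
  have hYp := hUpos.trans_le hYc
  rw [SimpleGraph.edgeDensity_def, card_interedges_eq_edgeCount]
  push_cast
  rw [le_div_iff₀ (by positivity)]
  refine le_trans ?_ h1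
  rw [mul_assoc]
  exact mul_le_mul_of_nonneg_right hγ (by positivity)

/-- Every set of at least `w₀` vertices contains an absorber of order at most `w₀` for the
vertices of high degree into a certain part of it. -/
lemma exists_absorber_in_large_set [Fintype α] [Nonempty α] [Fintype β] [Nonempty β]
    (G : SimpleGraph α) (H : SimpleGraph β) (K : SimpleGraph V) (hK : G.Free Kᶜ) {Δ ρ h : ℕ}
    (hΔ : 2 ≤ Δ) (hG : ∀ x, (nbIn G univ x).card ≤ Δ) (hH : ∀ x, (nbIn H univ x).card ≤ Δ)
    (hα : Fintype.card α ≤ ρ) (hβ : Fintype.card β ≤ ρ) (hh : 8 * Δ ≤ 2 ^ h) (W : Finset V)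
    (hW : (96 * Δ * (512 * Δ ^ 2 * (16 * Δ) ^ (Δ + 2)) * (16 * Δ) ^ (Δ + 1)) ^ h *
      (512 * Δ ^ 2 * (16 * Δ) ^ (Δ + 2) * (8 * Δ ^ 2 * (16 * Δ) ^ (Δ + 1)) * ρ) ≤ W.card) :
    ∃ Y A : Finset V, Y ⊆ A ∧ A ⊆ W ∧
      A.card ≤ (96 * Δ * (512 * Δ ^ 2 * (16 * Δ) ^ (Δ + 2)) * (16 * Δ) ^ (Δ + 1)) ^ h *
        (512 * Δ ^ 2 * (16 * Δ) ^ (Δ + 2) * (8 * Δ ^ 2 * (16 * Δ) ^ (Δ + 1)) * ρ) ∧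
      2 * Fintype.card α ≤ Y.card ∧
      ∀ R : Finset V, Disjoint R A → R.card ≤ ρ →
        (∀ v ∈ R, 1 / (16 * Δ) * (Y.card : ℝ) ≤ (nbIn K Y v).card) →
        HasTiling H (K.induce ((A : Set V) ∪ (R : Set V))) := by
  classical
  -- Working in a subset of exactly the threshold size makes the bound on `|A|` automatic.
  obtain ⟨W', hW'W, hW'c⟩ := exists_subset_card_eq hW
  have hρ1 : 1 ≤ ρ := Fintype.card_pos.trans_le hα
  have hΔR : (2 : ℝ) ≤ Δ := by exact_mod_cast hΔ
  have hρR : (1 : ℝ) ≤ ρ := by exact_mod_cast hρ1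
  set T : ℕ := 16 * Δ with hT
  have hTR : (T : ℝ) = 16 * Δ := by rw [hT]; push_cast; ring
  have hTpos : 0 < T := by omega
  have hT1 : (1 : ℝ) ≤ T := by exact_mod_cast hTpos
  -- Since `3/4 γ = 1/T`, taking `n ≈ |B|/c` flexible fillers leaves at least `512Δ²n` candidates in
  -- `B` for the template. For the cover of `R`, at least `u = n / T^(Δ+1)` candidates remain in
  -- `Y`, and `ε` is chosen so that `Δm ≤ u/8`.
  set c : ℕ := 512 * Δ ^ 2 * T ^ (Δ + 2) with hc
  have hcpos : 0 < c := by positivity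
  have hcR : (0 : ℝ) < c := by exact_mod_cast hcpos
  set P : ℝ := (T : ℝ) ^ (Δ + 1) with hP
  have hP1 : 1 ≤ P := one_le_pow₀ hT1
  obtain ⟨B, hBW', hBM, hB⟩ := exists_denseAbove_subset K G hK hΔ hG hα hh
    (ε := 1 / (16 * Δ * c * P)) (by positivity)
    (by
      rw [div_le_one (by positivity)]
      have h1 : (1 : ℝ) ≤ c := by exact_mod_cast hcpos
      have h2 : (1 : ℝ) ≤ 16 * Δ := by linarith
      have h3 : (1 : ℝ) ≤ 16 * Δ * c := by nlinarith
      nlinarith) W' ((c * (8 * Δ ^ 2 * T ^ (Δ + 1)) * ρ : ℕ) : ℝ)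
    (by
      have h1 : 7 * ρ ≤ c * (8 * Δ ^ 2 * T ^ (Δ + 1)) * ρ := by
        refine Nat.mul_le_mul_right _ ?_
        have h2 : 1 ≤ Δ ^ 2 * T ^ (Δ + 1) := Nat.one_le_iff_ne_zero.2 (by positivity)
        have h3 : 1 * (8 * Δ ^ 2 * T ^ (Δ + 1)) ≤ c * (8 * Δ ^ 2 * T ^ (Δ + 1)) :=
          Nat.mul_le_mul_right _ hcpos
        linarith
      exact_mod_cast h1)
    (by
      have : (6 : ℝ) / (1 / (16 * Δ * c * P)) = 96 * Δ * c * P := by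
        field_simp; norm_num
      rw [this, hW'c, hP]
      push_cast
      exact le_rfl)
  have hBM' : c * (8 * Δ ^ 2 * T ^ (Δ + 1)) * ρ ≤ B.card := by exact_mod_cast hBM
  set n := B.card / c with hn
  have hn1 : 8 * Δ ^ 2 * T ^ (Δ + 1) * ρ ≤ n := by
    rw [hn, Nat.le_div_iff_mul_le hcpos]
    refine le_trans (le_of_eq ?_) hBM'
    ring
  have hn1R : 8 * (Δ : ℝ) ^ 2 * P * ρ ≤ n := by rw [hP]; exact_mod_cast hn1
  have hnpos : 0 < n := lt_of_lt_of_le (by positivity) hn1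
  have hnR : (0 : ℝ) < n := by exact_mod_cast hnpos
  have hBn : (c : ℝ) * n ≤ B.card := by exact_mod_cast Nat.mul_div_le _ _
  have hBn' : (B.card : ℝ) ≤ 2 * c * n := by
    have h1 : B.card < c * (n + 1) := Nat.lt_mul_div_succ _ hcpos
    have h2 : B.card ≤ 2 * c * n := by nlinarith
    exact_mod_cast h2
  set m : ℝ := 1 / (16 * Δ * c * P) * B.card with hm
  set u : ℝ := n / P with hu
  have hBpos : (0 : ℝ) < B.card := lt_of_lt_of_le (by positivity) hBn
  have hmpos : 0 < m := by positivity
  have hum : Δ * m ≤ u / 8 := by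
    calc Δ * m ≤ Δ * (1 / (16 * Δ * c * P) * (2 * c * n)) := by rw [hm]; gcongr
      _ = u / 8 := by rw [hu]; field_simp; norm_num
  have hu1 : 8 * (Δ : ℝ) ^ 2 * ρ ≤ u := by
    rw [hu, le_div_iff₀ (by positivity)]
    linarith
  have hun : u ≤ n := div_le_self hnR.le hP1
  have hΔ2 : (4 : ℝ) ≤ (Δ : ℝ) ^ 2 := by nlinarith
  have hΔn : 4 * (n : ℝ) ≤ (Δ : ℝ) ^ 2 * n := mul_le_mul_of_nonneg_right hΔ2 hnR.le
  have hΔρ : 4 * (ρ : ℝ) ≤ (Δ : ℝ) ^ 2 * ρ := mul_le_mul_of_nonneg_right hΔ2 (by linarith)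
  have hΔm : 2 * m ≤ Δ * m := mul_le_mul_of_nonneg_right hΔR hmpos.le
  have hu32 : 32 ≤ u := by linarith
  have hm2 : m ≤ u / 16 := by linarith
  have hθ : (3 / 4 * (1 / (12 * Δ)) : ℝ) = 1 / T := by rw [hTR]; field_simp; norm_num
  have hQ1 : 512 * (Δ : ℝ) ^ 2 * n ≤ (3 / 4 * (1 / (12 * Δ)) : ℝ) ^ (Δ + 2) * B.card := by
    rw [hθ, div_pow, one_pow, one_div_mul_eq_div, le_div_iff₀ (by positivity)]
    refine le_trans (le_of_eq ?_) hBn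
    rw [hc]; push_cast; ring
  have hQ2 : (3 / 4 * (1 / (12 * Δ)) : ℝ) ^ Δ * (1 / (16 * Δ) * n) = u := by
    have hT0 : (T : ℝ) ≠ 0 := by positivity
    rw [hθ, ← hTR, hu, hP, pow_succ, div_pow, one_pow]
    field_simp
  have hβR : (Fintype.card β : ℝ) ≤ ρ := by exact_mod_cast hβ
  obtain ⟨Y, A, hYA, hAB, hYc, habs⟩ := exists_absorber_of_denseAbove (ρ := ρ) (n := n) H K
    (by omega) hH (γ := 1 / (12 * Δ)) (m := m) (θ := 1 / (16 * Δ)) (by positivity)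
    (by rw [div_le_one (by positivity)]; linarith) hmpos (by positivity)
    (by rw [div_le_one (by positivity)]; linarith) hB
    (by linarith)
    (by
      push_cast
      linarith)
    (by rw [hQ2]; linarith)
    (by
      rw [hQ2]
      push_cast
      linarith)
  refine ⟨Y, A, hYA, (hAB.trans hBW').trans hW'W,
    (card_le_card (hAB.trans hBW')).trans_eq hW'c, ?_, habs⟩
  rw [hYc]
  have h1 : (Fintype.card α : ℝ) ≤ ρ := by exact_mod_cast hα
  have h2 : 2 * (Fintype.card α : ℝ) ≤ n := by linarith
  exact_mod_cast h2

/-- By the convention `n % 0 = n`, the empty family is a tiling. -/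
lemma hasTiling_of_isEmpty [Finite V] [IsEmpty β] (H : SimpleGraph β) (K : SimpleGraph V) :
    HasTiling H K := by
  refine ⟨0, fun i => i.elim0, fun i => i.elim0, ?_⟩
  simp

end Main

section Main

variable {α β V : Type*}

/-- Inside a set that is not too small there is a large bi-dense set. -/
lemma exists_large_isBiDense [Fintype α] [Nonempty α] (G : SimpleGraph α) (K : SimpleGraph V)
    [DecidableRel K.Adj] (hK : G.Free Kᶜ) {Δ k h : ℕ} (hΔ : 2 ≤ Δ)
    (hG : ∀ x, (nbIn G univ x).card ≤ Δ) (hα : Fintype.card α ≤ k) (hh : 8 * Δ ≤ 2 ^ h)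
    (hh' : (h : ℝ) ≤ 4 * Real.logb 2 (Δ : ℝ)) {N : ℝ}
    (hN : 2 ^ (512 * ((Δ : ℝ) * Real.logb 2 (Δ : ℝ) ^ 2)) * (k : ℝ) ≤ N) (W : Finset V)
    (hW : N / 4 ^ (Δ + 1) ≤ W.card) :
    ∃ X ⊆ W, N / 2 ^ (200 * ((Δ : ℝ) * Real.logb 2 (Δ : ℝ) ^ 2)) ≤ X.card ∧
      IsBiDense K (1 / ((2 : ℝ) ^ (10 * Δ + 11) * (Δ : ℝ) ^ (2 * Δ + 4)))
        (1 / ((2 : ℝ) ^ 4 * (Δ : ℝ))) X := by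
  have hnum := dense_set_numeric hΔ hh'
  set x := (Δ : ℝ) * Real.logb 2 (Δ : ℝ) ^ 2 with hx
  have hΔR : (2 : ℝ) ≤ Δ := by exact_mod_cast hΔ
  have hx2 : 2 ≤ x := by
    obtain ⟨m1, -, -, m4⟩ := monomial_bounds hΔR (one_le_logb hΔ)
    exact m1.trans m4
  have hk1 : (1 : ℝ) ≤ k := by exact_mod_cast Fintype.card_pos.trans_le hα
  have hN0 : 0 ≤ N := le_trans (by positivity) hN
  set ε : ℝ := 1 / ((2 : ℝ) ^ (10 * Δ + 11) * (Δ : ℝ) ^ (2 * Δ + 4)) with hε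
  have hε0 : 0 < ε := by positivity
  have hε1 : ε ≤ 1 := by
    rw [hε, div_le_one (by positivity)]
    have h1 : (1 : ℝ) ≤ 2 ^ (10 * Δ + 11) := one_le_pow₀ (by norm_num)
    have h2 : (1 : ℝ) ≤ (Δ : ℝ) ^ (2 * Δ + 4) := one_le_pow₀ (by linarith)
    nlinarith
  have h6 : 6 / ε = 6 * ((2 : ℝ) ^ (10 * Δ + 11) * (Δ : ℝ) ^ (2 * Δ + 4)) := by
    rw [hε]; field_simp
  have hq : 0 < (6 / ε) ^ h := by positivity
  have hlower : N / 2 ^ (87 * x) ≤ W.card / (6 / ε) ^ h := by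
    rw [le_div_iff₀ hq]
    refine le_trans ?_ hW
    rw [div_mul_eq_mul_div, div_le_div_iff₀ (by positivity) (by positivity), mul_assoc]
    refine mul_le_mul_of_nonneg_left ?_ hN0
    rw [h6]
    exact hnum
  have h7 : 7 * (k : ℝ) ≤ N / 2 ^ (87 * x) := by
    rw [le_div_iff₀ (by positivity)]
    refine le_trans ?_ hN
    have h8 : (7 : ℝ) ≤ 2 ^ (3 : ℝ) := by norm_num
    calc 7 * (k : ℝ) * 2 ^ (87 * x) = 7 * 2 ^ (87 * x) * k := by ring
      _ ≤ 2 ^ (3 : ℝ) * 2 ^ (87 * x) * k := by gcongr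
      _ = 2 ^ (3 + 87 * x) * k := by rw [Real.rpow_add (by norm_num)]
      _ ≤ _ := by
          refine mul_le_mul_of_nonneg_right ?_ (by linarith)
          exact Real.rpow_le_rpow_of_exponent_le (by norm_num) (by linarith)
  obtain ⟨X, hXW, hXc, hX⟩ := exists_denseAbove_subset K G hK hΔ hG hα hh hε0 hε1 W
    (W.card / (6 / ε) ^ h) (h7.trans hlower) (by rw [mul_div_cancel₀ _ hq.ne'])
  refine ⟨X, hXW, le_trans ?_ (hlower.trans hXc), isBiDense_of_denseAbove K hε0 ?_ ?_ hX⟩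
  · refine div_le_div_of_nonneg_left hN0 (by positivity) ?_
    exact Real.rpow_le_rpow_of_exponent_le (by norm_num) (by linarith)
  · refine one_div_le_one_div_of_le (by positivity) ?_
    norm_num
    linarith
  · rw [← card_pos]
    have : (0 : ℝ) < X.card := lt_of_lt_of_le (by linarith) (h7.trans (hlower.trans hXc))
    exact_mod_cast this

/-- The main construction in the case where `H` has vertices. -/
lemma exists_biDense_and_absorber [Fintype α] [Nonempty α] [Fintype β] [Nonempty β] [Fintype V]
    (G : SimpleGraph α) (H : SimpleGraph β) (K : SimpleGraph V) [DecidableRel K.Adj]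
    (hK : G.Free Kᶜ) {Δ k h : ℕ} (hΔ : 2 ≤ Δ)
    (hG : ∀ x, (nbIn G univ x).card ≤ Δ) (hH : ∀ x, (nbIn H univ x).card ≤ Δ)
    (hα : Fintype.card α ≤ k) (hβ : Fintype.card β ≤ k) (hh : 8 * Δ ≤ 2 ^ h)
    (hh' : (h : ℝ) ≤ 4 * Real.logb 2 (Δ : ℝ))
    (hN : 2 ^ (512 * ((Δ : ℝ) * Real.logb 2 (Δ : ℝ) ^ 2)) * (k : ℝ) ≤ Fintype.card V) :
    ∃ X A : Finset V,
      Fintype.card V / 2 ^ (200 * ((Δ : ℝ) * Real.logb 2 (Δ : ℝ) ^ 2)) ≤ (X.card : ℝ) ∧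
      IsBiDense K (1 / ((2 : ℝ) ^ (10 * Δ + 11) * (Δ : ℝ) ^ (2 * Δ + 4)))
        (1 / ((2 : ℝ) ^ 4 * (Δ : ℝ))) X ∧
      IsAbsorber H (ramsey G H) K A X ∧
      (A.card : ℝ) ≤ 2 ^ (200 * ((Δ : ℝ) * Real.logb 2 (Δ : ℝ) ^ 2)) * (k : ℝ) := by
  have hnum1 := ramsey_bound_numeric hΔ hh'
  have hnum2 := absorber_bound_numeric hΔ hh'
  have hram := ramsey_le G H hΔ hG hH hα hβ hh
  set ρ : ℕ := (48 * Δ * (16 * Δ) ^ Δ) ^ h * (16 * k * Δ * (16 * Δ) ^ Δ) with hρ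
  have hΔ0 : 0 < Δ := by omega
  have hkρ : k ≤ ρ := by
    have h1 : 1 ≤ (48 * Δ * (16 * Δ) ^ Δ) ^ h * (16 * Δ * (16 * Δ) ^ Δ) :=
      Nat.one_le_iff_ne_zero.2 (by positivity)
    calc k = k * 1 := (mul_one k).symm
      _ ≤ k * ((48 * Δ * (16 * Δ) ^ Δ) ^ h * (16 * Δ * (16 * Δ) ^ Δ)) := Nat.mul_le_mul_left _ h1
      _ = ρ := by rw [hρ]; ring
  have habs := exists_absorber_in_large_set G H K hK hΔ hG hH (hα.trans hkρ) (hβ.trans hkρ) hh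
  set w₀ : ℕ := (96 * Δ * (512 * Δ ^ 2 * (16 * Δ) ^ (Δ + 2)) * (16 * Δ) ^ (Δ + 1)) ^ h *
      (512 * Δ ^ 2 * (16 * Δ) ^ (Δ + 2) * (8 * Δ ^ 2 * (16 * Δ) ^ (Δ + 1)) * ρ) with hw₀
  set x := (Δ : ℝ) * Real.logb 2 (Δ : ℝ) ^ 2 with hx
  have hΔR : (2 : ℝ) ≤ Δ := by exact_mod_cast hΔ
  obtain ⟨m1, m2, -, m4⟩ := monomial_bounds hΔR (one_le_logb hΔ)
  have hx2 : 2 ≤ x := m1.trans m4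
  have hρR : (ρ : ℝ) ≤ 2 ^ (42 * x) * k := by
    refine le_trans (le_of_eq ?_) (mul_le_mul_of_nonneg_right hnum1 (Nat.cast_nonneg k))
    rw [hρ]; push_cast; ring
  have hw₀R : (w₀ : ℝ) ≤ 2 ^ (176 * x) * k := by
    calc (w₀ : ℝ) = ((96 * Δ * (512 * Δ ^ 2 * (16 * Δ) ^ (Δ + 2)) * (16 * Δ) ^ (Δ + 1)) ^ h *
        (512 * Δ ^ 2 * (16 * Δ) ^ (Δ + 2) * (8 * Δ ^ 2 * (16 * Δ) ^ (Δ + 1)))) * (ρ : ℝ) := by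
          rw [hw₀]; push_cast; ring
      _ ≤ 2 ^ (134 * x) * (2 ^ (42 * x) * k) := by gcongr
      _ = 2 ^ (134 * x + 42 * x) * k := by rw [Real.rpow_add (by norm_num)]; ring
      _ = _ := by congr 2; ring
  have hw₀N : (w₀ : ℝ) ≤ Fintype.card V / 4 ^ (Δ + 1) := by
    rw [le_div_iff₀ (by positivity)]
    refine le_trans ?_ hN
    have h4 : (4 : ℝ) ^ (Δ + 1) = 2 ^ (2 * ((Δ : ℝ) + 1)) := by
      rw [Real.rpow_mul (by norm_num), ← Real.rpow_natCast]; push_cast; norm_num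
    calc (w₀ : ℝ) * 4 ^ (Δ + 1) ≤ 2 ^ (176 * x) * k * 2 ^ (2 * ((Δ : ℝ) + 1)) := by
          rw [h4]; gcongr
      _ = 2 ^ (176 * x + 2 * ((Δ : ℝ) + 1)) * k := by rw [Real.rpow_add (by norm_num)]; ring
      _ ≤ _ := by
          refine mul_le_mul_of_nonneg_right ?_ (Nat.cast_nonneg k)
          exact Real.rpow_le_rpow_of_exponent_le (by norm_num) (by linarith)
  -- The property asked of `(Y, A)` is that `A` absorbs small sets with high degree into `Y`. The
  -- set `X₀` found here has such degrees and avoids `A`, so all its subsets qualify.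
  obtain ⟨Y, A, X₀, hP, hAc, -, hX₀A, hX₀c, hdeg⟩ := exists_many_high_degree K G hK hG
    (θ := 1 / (16 * Δ)) (by positivity)
    (by
      rw [mul_one_div, div_le_div_iff₀ (by positivity) (by norm_num)]
      linarith)
    (fun Y A => ∀ R : Finset V, Disjoint R A → R.card ≤ ρ →
        (∀ v ∈ R, 1 / (16 * Δ) * (Y.card : ℝ) ≤ (nbIn K Y v).card) →
        HasTiling H (K.induce ((A : Set V) ∪ (R : Set V))))
    hw₀N (Nat.cast_nonneg _)
    (fun W hW => by
      obtain ⟨Y, A, h1, h2, h3, h4, h5⟩ := habs W (by exact_mod_cast hW)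
      exact ⟨Y, A, h1, h2, by exact_mod_cast h3, h4, h5⟩)
    univ (by rw [card_univ, mul_div_cancel₀ _ (by positivity)])
  obtain ⟨X, hXX₀, hXc, hXd⟩ := exists_large_isBiDense G K hK hΔ hG hα hh hh' hN X₀ hX₀c
  refine ⟨X, A, hXc, hXd, fun R hRX hRc => hP R ?_ (hRc.trans hram)
    fun v hv => hdeg v (hXX₀ (hRX hv)), ?_⟩
  · exact disjoint_of_subset_left (hRX.trans hXX₀) hX₀A
  · refine (hAc.trans hw₀R).trans (mul_le_mul_of_nonneg_right ?_ (Nat.cast_nonneg k))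
    exact Real.rpow_le_rpow_of_exponent_le (by norm_num) (by linarith)

end Main

end RamseyTiling

theorem mainTheorem6 {α β V : Type*} [Fintype α] [Fintype β] [Fintype V]
    (G : SimpleGraph α) (H : SimpleGraph β) (K : SimpleGraph V)
    [DecidableRel G.Adj] [DecidableRel H.Adj] [DecidableRel K.Adj]
    (Δ k : ℕ) (hΔ : 2 ≤ Δ) (hG : G.maxDegree ≤ Δ) (hH : H.maxDegree ≤ Δ)
    (hk : k = max (Fintype.card α) (Fintype.card β))
    (hN : (2 : ℝ) ^ (512 * (Δ : ℝ) * (Real.logb 2 (Δ : ℝ)) ^ 2) * (k : ℝ)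
      ≤ (Fintype.card V : ℝ))
    (hK : G.Free Kᶜ) :
    ∃ X A : Finset V,
      (Fintype.card V : ℝ) / (2 : ℝ) ^ (200 * (Δ : ℝ) * (Real.logb 2 (Δ : ℝ)) ^ 2)
        ≤ (X.card : ℝ) ∧
      RamseyTiling.IsBiDense K
        (1 / ((2 : ℝ) ^ (10 * Δ + 11) * (Δ : ℝ) ^ (2 * Δ + 4)))
        (1 / ((2 : ℝ) ^ 4 * (Δ : ℝ))) X ∧
      RamseyTiling.IsAbsorber H (RamseyTiling.ramsey G H) K A X ∧
      (A.card : ℝ) ≤ (2 : ℝ) ^ (200 * (Δ : ℝ) * (Real.logb 2 (Δ : ℝ)) ^ 2) * (k : ℝ) := by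
  classical
  have hα : Nonempty α := by
    rw [← not_isEmpty_iff]
    intro _
    exact hK SimpleGraph.IsContained.of_isEmpty
  have hG' := RamseyTiling.card_nbIn_le_of_maxDegree_le G hG
  have hH' := RamseyTiling.card_nbIn_le_of_maxDegree_le H hH
  have hαk : Fintype.card α ≤ k := hk ▸ le_max_left _ _
  have hβk : Fintype.card β ≤ k := hk ▸ le_max_right _ _
  have hh := RamseyTiling.eight_mul_le_two_pow_clog Δ
  have hh' := RamseyTiling.clog_add_three_le hΔ
  rw [mul_assoc] at hN
  rw [mul_assoc 200]
  -- If `H` has no vertices, the empty set is an absorber and only the bi-dense set is needed.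
  rcases isEmpty_or_nonempty β with hβ | hβ
  · obtain ⟨X, -, hXc, hX⟩ := RamseyTiling.exists_large_isBiDense G K hK hΔ hG' hαk hh hh' hN
      Finset.univ (div_le_self (Nat.cast_nonneg _) (one_le_pow₀ (by norm_num)))
    refine ⟨X, ∅, hXc, hX, fun R _ _ => RamseyTiling.hasTiling_of_isEmpty H _, ?_⟩
    rw [Finset.card_empty, Nat.cast_zero]
    positivity
  · exact RamseyTiling.exists_biDense_and_absorber G H K hK hΔ hG' hH' hαk hβk hh hh' hN
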